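/- Let $n\ge 2$ and let $\Omega\subset\mathbb R^n$ be a bounded, connected open set with $C^2$ boundary $\Gamma=\overline{\Gamma_0\cup\Gamma_1}$, $\Gamma_0\cap\Gamma_1=\emptyset$. Let $D\in C^2(\Omega)$ satisfy $1/c_0\le D\le c_0$ for some $c_0>0$, with $D-1$ compactly supported in $\Omega$, and let $g=D^{-1}(x)\,dx^2$. Let $d\in C^3(\overline\Omega)$ be positive on $\overline\Omega$ and such that, with $\mathcal D$ the Levi-Civita connection of $g$ and $\mathcal D d=\nabla_g d$, * $\partial d/\partial\nu\le 0$ on $\Gamma_0$, where $\nu$ is the unit outward normal; * $\mathcal D^2d(X,X)=\langle \mathcal D_X(\mathcal Dd),X\rangle_g\ge 2|X|_g^2$ for all $x\in\Omega$ and all tangent vectors $X$ at $x$; * $\inf_{\overline\Omega}|\mathcal Dd|_g>0$. Let $T>0$, let $R\in W^{3,\infty}(\Omega\times(0,T))$, identified with its representative that is continuous on $\Omega\times[0,T)$, and let $r_0>0$. Then there exist $C>0$ and $\tau_0>0$, depending only on $\Omega,\Gamma_0,\Gamma_1,D,c_0,d,T,R,r_0$, such that the following holds. Let $K\subset\Omega$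 be a compact set with $C^2$ boundary such that $|R(x,0)|\ge r_0$ for a.e. $x\in K$. Let $F\in H^2_0(\Omega)$ have (essential) support contained in $\operatorname{Int}K$, and let the function $w_{tt}(\cdot,0)$ on $\Omega$ be given by $$w_{tt}(x,0)=R(x,0)\,\Delta F(x)+2\nabla R(x,0)\cdot\nabla F(x)+\Delta R(x,0)\,F(x)\qquad\text{for a.e. }x\in\Omega .$$ Then for all $\tau\ge\tau_0$ both integrals below are finite and $$\int_\Omega e^{2\tau d}\bigl(|\Delta F|^2+|\nabla F|^2+|F|^2\bigr)\,dx\le C\int_\Omega e^{2\tau d}\,w_{tt}(x,0)^2\,dx .$$ Here $\nabla F$ and $\Delta F$ are the weak gradient and weak Laplacian, and $\nabla$, $\Delta$ are Euclidean. -/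

import Mathlib

open MeasureTheory Set Filter Topology
open scoped ContDiff ENNReal

/-! ### Weak derivatives and Sobolev spaces -/

section Sobolev

variable {E : Type*} [NormedAddCommGroup E] [NormedSpace ℝ E]

/-- Test functions: the elements of `C_c^∞(U)`. -/
structure IsTestFunction (U : Set E) (φ : E → ℝ) : Prop where
  smooth : ContDiff ℝ ∞ φ
  compactSupport : HasCompactSupport φ
  support_subset : tsupport φ ⊆ U

/-- `g` is the weak derivative `∂_{v 0} ⋯ ∂_{v (k-1)} f` on the open set `U`. -/
def HasWeakDeriv [MeasureSpace E] (U : Set E) {k : ℕ} (v : Fin k → E) (f g : E → ℝ) : Prop :=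
  LocallyIntegrableOn f U volume ∧ LocallyIntegrableOn g U volume ∧
    ∀ φ : E → ℝ, IsTestFunction U φ →
      ∫ x in U, f x * iteratedFDeriv ℝ k φ x v = (-1) ^ k * ∫ x in U, g x * φ x

/-- `f ∈ W^{k,p}(U)`: all weak derivatives of order `≤ k` (order `0` being `f` itself) exist and
lie in `L^p(U)`. -/
def MemSobolev [MeasureSpace E] (k : ℕ) (p : ℝ≥0∞) (U : Set E) (f : E → ℝ) : Prop :=
  ∀ j ≤ k, ∀ v : Fin j → E, ∃ g : E → ℝ,
    MemLp g p (volume.restrict U) ∧ HasWeakDeriv U v f g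

/-- `f ∈ H^k_0(U)`: `f` lies in `H^k(U) = W^{k,2}(U)` and is a limit, in the norm of `H^k(U)`, of
functions in `C_c^∞(U)`. -/
def MemHZero [MeasureSpace E] (k : ℕ) (U : Set E) (f : E → ℝ) : Prop :=
  MemSobolev k 2 U f ∧
    ∃ φ : ℕ → E → ℝ, (∀ m, IsTestFunction U (φ m)) ∧
      ∀ j ≤ k, ∀ v : Fin j → E, ∀ g : E → ℝ, HasWeakDeriv U v f g →
        Tendsto (fun m => eLpNorm (fun x => iteratedFDeriv ℝ j (φ m) x v - g x) 2
          (volume.restrict U)) atTop (𝓝 0)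

/-- The essential support of `f`, as a function on `U`, is contained in `V` (for sets `V` whose
closure is a subset of `U`). -/
def EssSupportedIn [MeasureSpace E] (U : Set E) (f : E → ℝ) (V : Set E) : Prop :=
  ∃ S : Set E, IsClosed S ∧ S ⊆ V ∧ ∀ᵐ x ∂(volume.restrict U), x ∉ S → f x = 0

end Sobolev

section WeakGradient

variable {E : Type*} [NormedAddCommGroup E] [InnerProductSpace ℝ E]

/-- The vector field `P` is the weak gradient of `f` on `U`. -/
def HasWeakGradient [MeasureSpace E] (U : Set E) (f : E → ℝ) (P : E → E) : Prop :=
  ∀ v : E, HasWeakDeriv U (fun _ : Fin 1 => v) f (fun x => inner ℝ (P x) v)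

/-- `L` is the weak (distributional) Laplacian of `f` on `U`. -/
def HasWeakLaplacian [FiniteDimensional ℝ E] [MeasureSpace E] (U : Set E) (f L : E → ℝ) : Prop :=
  LocallyIntegrableOn f U volume ∧ LocallyIntegrableOn L U volume ∧
    ∀ φ : E → ℝ, IsTestFunction U φ →
      ∫ x in U, f x * Laplacian.laplacian φ x = ∫ x in U, L x * φ x

end WeakGradient

/-! ### Sets with `C²` boundary -/

section Boundary

variable {E : Type*} [NormedAddCommGroup E] [InnerProductSpace ℝ E]

/-- `ρ` is a `C²` defining function of the set `A` near the boundary point `x`. -/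
structure IsC2DefiningFunctionAt (A : Set E) (x : E) (ρ : E → ℝ) : Prop where
  contDiffAt : ContDiffAt ℝ 2 ρ x
  fderiv_ne_zero : fderiv ℝ ρ x ≠ 0
  interior_iff : ∀ᶠ y in 𝓝 x, y ∈ interior A ↔ ρ y < 0
  closure_iff : ∀ᶠ y in 𝓝 x, y ∈ closure A ↔ ρ y ≤ 0

/-- The boundary of `A` is of class `C²`, with `A` locally on one side of it. -/
def HasC2Boundary (A : Set E) : Prop :=
  ∀ x ∈ frontier A, ∃ ρ : E → ℝ, IsC2DefiningFunctionAt A x ρ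

/-- `ν` is the unit outward normal of `A` at its boundary point `x`. -/
def IsUnitOutwardNormal [CompleteSpace E] (A : Set E) (x ν : E) : Prop :=
  x ∈ frontier A ∧ ∃ ρ : E → ℝ, IsC2DefiningFunctionAt A x ρ ∧
    ν = ‖gradient ρ x‖⁻¹ • gradient ρ x

end Boundary

/-! ### Riemannian metrics on open subsets of `ℝⁿ`, in the global chart -/

noncomputable section Riemannian

variable {n : ℕ}

/-- `∂f/∂x_i`. -/
def partialD (i : Fin n) (f : EuclideanSpace ℝ (Fin n) → ℝ) (x : EuclideanSpace ℝ (Fin n)) : ℝ :=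
  fderiv ℝ f x (EuclideanSpace.single i 1)

/-- The matrix field of the metric `g = D(x)⁻¹ dx²`. -/
def conformalMetric (D : EuclideanSpace ℝ (Fin n) → ℝ) :
    EuclideanSpace ℝ (Fin n) → Matrix (Fin n) (Fin n) ℝ :=
  fun x => (D x)⁻¹ • (1 : Matrix (Fin n) (Fin n) ℝ)

/-- `⟨X, Y⟩_g` at `x`. -/
def gInner (g : EuclideanSpace ℝ (Fin n) → Matrix (Fin n) (Fin n) ℝ)
    (x : EuclideanSpace ℝ (Fin n)) (X Y : Fin n → ℝ) : ℝ :=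
  ∑ i, ∑ j, g x i j * X i * Y j

/-- The Christoffel symbol `Γ^k_{ij}` of the Levi-Civita connection of `g`. -/
def christoffel (g : EuclideanSpace ℝ (Fin n) → Matrix (Fin n) (Fin n) ℝ)
    (x : EuclideanSpace ℝ (Fin n)) (k i j : Fin n) : ℝ :=
  (1 / 2) * ∑ l, (g x)⁻¹ k l *
    (partialD i (fun y => g y j l) x + partialD j (fun y => g y i l) x
      - partialD l (fun y => g y i j) x)

/-- The covariant derivative `𝒟_X V` at `x` of the vector field `V`. -/
def covDeriv (g : EuclideanSpace ℝ (Fin n) → Matrix (Fin n) (Fin n) ℝ)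
    (V : EuclideanSpace ℝ (Fin n) → Fin n → ℝ)
    (x : EuclideanSpace ℝ (Fin n)) (X : Fin n → ℝ) : Fin n → ℝ :=
  fun k => ∑ i, X i * (partialD i (fun y => V y k) x + ∑ j, christoffel g x k i j * V x j)

/-- The Riemannian gradient `𝒟f = ∇_g f`. -/
def gGrad (g : EuclideanSpace ℝ (Fin n) → Matrix (Fin n) (Fin n) ℝ)
    (f : EuclideanSpace ℝ (Fin n) → ℝ) (x : EuclideanSpace ℝ (Fin n)) : Fin n → ℝ :=
  fun k => ∑ l, (g x)⁻¹ k l * partialD l f x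

/-- The Riemannian Hessian `𝒟²f(X, Y) = ⟨𝒟_X(𝒟f), Y⟩_g` at `x`. -/
def gHess (g : EuclideanSpace ℝ (Fin n) → Matrix (Fin n) (Fin n) ℝ)
    (f : EuclideanSpace ℝ (Fin n) → ℝ) (x : EuclideanSpace ℝ (Fin n)) (X Y : Fin n → ℝ) : ℝ :=
  gInner g x (covDeriv g (gGrad g f) x X) Y

end Riemannian

/-! ### The standing assumptions -/

/-- The coefficient `D` is of class `C²` on `Ω`, `1/c₀ ≤ D ≤ c₀`, and `D - 1` is compactly
supported in `Ω`. -/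
structure IsAdmissibleCoefficient {n : ℕ} (Ω : Set (EuclideanSpace ℝ (Fin n))) (c₀ : ℝ)
    (D : EuclideanSpace ℝ (Fin n) → ℝ) : Prop where
  c₀_pos : 0 < c₀
  contDiffOn : ContDiffOn ℝ 2 D Ω
  lower : ∀ x ∈ Ω, 1 / c₀ ≤ D x
  upper : ∀ x ∈ Ω, D x ≤ c₀
  compactSupport : ∃ S, IsCompact S ∧ S ⊆ Ω ∧ ∀ x ∈ Ω \ S, D x = 1

/-- The geometrical assumptions on the weight `d`: it is of class `C³` up to the boundary,
positive, strictly convex in the metric `g` on `Ω`, without critical points on the closure, and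
its normal derivative is non-positive on the part `Γ₀` of the boundary. -/
structure GeometricAssumptions {n : ℕ} (Ω Γ₀ : Set (EuclideanSpace ℝ (Fin n)))
    (g : EuclideanSpace ℝ (Fin n) → Matrix (Fin n) (Fin n) ℝ)
    (d : EuclideanSpace ℝ (Fin n) → ℝ) : Prop where
  contDiffOn : ContDiffOn ℝ 3 d (closure Ω)
  normal_deriv : ∀ x ∈ Γ₀, ∀ ν, IsUnitOutwardNormal Ω x ν →
    fderivWithin ℝ d (closure Ω) x ν ≤ 0
  convex : ∀ x ∈ Ω, ∀ X : Fin n → ℝ, 2 * gInner g x X X ≤ gHess g d x X X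
  pos : ∀ x ∈ closure Ω, 0 < d x
  /-- By continuity a lower bound on `Ω` is the same as one on the closure. -/
  no_critical : ∃ c > 0, ∀ x ∈ Ω, c ≤ Real.sqrt (gInner g x (gGrad g d x) (gGrad g d x))

/-! ### Coordinate calculus: gradients, Laplacian and Hessian through partial derivatives. -/

section PartialDerivatives

variable {n : ℕ} {f g : EuclideanSpace ℝ (Fin n) → ℝ} {x : EuclideanSpace ℝ (Fin n)}

/-! The prescribed function $w_{tt}(\cdot,0)$ equals $R(\cdot,0)\Delta F$ up to terms of lower order
in $F$. Where $|R(\cdot,0)|\ge r_0$ it therefore controls $\Delta F$ pointwise, with an error made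
of $\nabla F$ and $F$ (`sq_mul_sq_le_of_eq`). Off the support of $F$, which lies in $K$, the weak
Laplacian vanishes by locality (`ae_eq_zero_of_weak_local`), so no lower bound on $R$ is needed
there. The error is absorbed by an elliptic Carleman estimate, $\tau c\int e^{2\tau d}(|\nabla
F|^2+F^2)\le A\int e^{2\tau d}|\Delta F|^2$ (`MemHZero.carleman_estimate`): for large $\tau$ it
costs at most half of the $\Delta F$ term.

The Carleman estimate concerns the Euclidean Laplacian, while $d$ is convex for $g=D^{-1}dx^2$.
Expanding the $g$-Hessian (`gHess_conformalMetric`) gives the Euclidean Hessian of $d$ plus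
$a|X|^2-2(b\cdot X)(\nabla d\cdot X)$, with $b=-\nabla D/(2D)$ and $a=b\cdot\nabla d$. Both
corrections are harmless. With $w=e^{\tau d}v$ one has $e^{\tau d}\Delta v=S+A$, where $S=\Delta
w+\tau^2|\nabla d|^2w$ and $A=-2\tau\nabla d\cdot\nabla w-\tau\Delta d\,w$. The cross term $2SA$
yields the Euclidean Hessian up to a divergence; the multiplier $a$ is brought in by adding
$\operatorname{div}(aw\nabla w)$ at the cost of part of $S^2$, and the term with $b$ contains the
factor $\nabla d\cdot\nabla w$, so part of $A^2$ pays for it. Positivity of the $\tau^3w^2$ term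
comes from convexity in the direction $\nabla d$ and the absence of critical points. For test
functions the divergence integrates to zero, and density passes the estimate to $H^2_0$.

The coefficients must also be bounded: $\nabla R(\cdot,0)$ and $\Delta R(\cdot,0)$ are classical
derivatives of a trace of a Sobolev function. Mollification bounds the spatial derivatives of order
at most two on slices $t>0$; a uniform second-order Taylor property (`HasQuadraticApprox`) survives
pointwise limits, first in the mollification parameter and then as $t\to0$. -/

theorem ContDiffAt.partialD {m k : ℕ∞ω} (hf : ContDiffAt ℝ m f x) (hk : k + 1 ≤ m) (i : Fin n) :
    ContDiffAt ℝ k (partialD i f) x :=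
  (hf.fderiv_right hk).clm_apply contDiffAt_const

theorem ContDiff.partialD {m k : ℕ∞ω} (hf : ContDiff ℝ m f) (hk : k + 1 ≤ m) (i : Fin n) :
    ContDiff ℝ k (partialD i f) :=
  contDiff_iff_contDiffAt.2 fun _ => hf.contDiffAt.partialD hk i

theorem Filter.EventuallyEq.partialD (h : f =ᶠ[𝓝 x] g) (i : Fin n) :
    partialD i f =ᶠ[𝓝 x] partialD i g :=
  (h.fderiv (𝕜 := ℝ)).mono fun y hy => by simp only [_root_.partialD, hy]

theorem Filter.EventuallyEq.partialD_zero (h : f =ᶠ[𝓝 x] 0) (i : Fin n) :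
    _root_.partialD i f =ᶠ[𝓝 x] 0 := by
  refine (h.partialD i).trans (Eventually.of_forall fun y => ?_)
  have : (0 : EuclideanSpace ℝ (Fin n) → ℝ) = fun _ => (0 : ℝ) := rfl
  simp [_root_.partialD, this]

theorem partialD_partialD_eq (hf : ContDiffAt ℝ 2 f x) (i j : Fin n) :
    partialD i (partialD j f) x =
      fderiv ℝ (fderiv ℝ f) x (EuclideanSpace.single i 1) (EuclideanSpace.single j 1) := by
  have h1 : DifferentiableAt ℝ (fderiv ℝ f) x :=
    (hf.fderiv_right (m := 1) (by norm_num)).differentiableAt one_ne_zero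
  have h2 := h1.hasFDerivAt.clm_apply
    (hasFDerivAt_const (EuclideanSpace.single j (1 : ℝ)) x)
  change fderiv ℝ (fun y => fderiv ℝ f y (EuclideanSpace.single j 1)) x
    (EuclideanSpace.single i 1) = _
  rw [h2.fderiv]
  simp

theorem partialD_comm (hf : ContDiffAt ℝ 2 f x) (i j : Fin n) :
    partialD i (partialD j f) x = partialD j (partialD i f) x := by
  rw [partialD_partialD_eq hf, partialD_partialD_eq hf]
  exact (hf.isSymmSndFDerivAt (by simp)).eq _ _

theorem HasCompactSupport.partialD (hf : HasCompactSupport f) (i : Fin n) :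
    HasCompactSupport (partialD i f) := hf.fderiv_apply (𝕜 := ℝ) _

theorem integral_partialD_eq_zero (hf : ContDiff ℝ 1 f) (hc : HasCompactSupport f) (i : Fin n) :
    ∫ x, partialD i f x = 0 := by
  have h := integral_mul_fderiv_eq_neg_fderiv_mul_of_integrable
    (μ := (volume : Measure (EuclideanSpace ℝ (Fin n)))) (f := fun _ => (1 : ℝ)) (g := f)
    (v := EuclideanSpace.single i (1 : ℝ)) (by simp) ?_ ?_ (by simp)
    (fun y _ => hf.differentiable one_ne_zero y)
  · simpa [_root_.partialD] using h
  · simpa using (((hf.continuous_fderiv one_ne_zero).clm_apply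
      continuous_const)).integrable_of_hasCompactSupport (hc.partialD i)
  · simpa using hf.continuous.integrable_of_hasCompactSupport hc


/-- The Euclidean inner product of the gradients of `f` and `g`. -/
noncomputable def gradDot (f g : EuclideanSpace ℝ (Fin n) → ℝ) (x : EuclideanSpace ℝ (Fin n)) : ℝ :=
  ∑ i, partialD i f x * partialD i g x

/-- The Laplacian in coordinates. -/
noncomputable def coordLaplacian (f : EuclideanSpace ℝ (Fin n) → ℝ)
    (x : EuclideanSpace ℝ (Fin n)) : ℝ :=
  ∑ i, partialD i (partialD i f) x

/-- The Hessian of `f` evaluated at the gradients of `g` and `h`. -/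
noncomputable def hessDot (f g h : EuclideanSpace ℝ (Fin n) → ℝ)
    (x : EuclideanSpace ℝ (Fin n)) : ℝ :=
  ∑ i, ∑ j, partialD i (partialD j f) x * partialD i g x * partialD j h x

theorem gradDot_comm (f g : EuclideanSpace ℝ (Fin n) → ℝ) : gradDot f g = gradDot g f :=
  funext fun _ => Finset.sum_congr rfl fun _ _ => mul_comm _ _

theorem gradDot_self_nonneg : 0 ≤ gradDot f f x :=
  Finset.sum_nonneg fun _ _ => mul_self_nonneg _

theorem hessDot_comm (hf : ContDiffAt ℝ 2 f x) (g h : EuclideanSpace ℝ (Fin n) → ℝ) :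
    hessDot f g h x = hessDot f h g x := by
  unfold hessDot
  rw [Finset.sum_comm]
  refine Finset.sum_congr rfl fun i _ => Finset.sum_congr rfl fun j _ => ?_
  rw [partialD_comm hf j i]; ring

theorem ContDiffAt.gradDot {m k : ℕ∞ω} (hf : ContDiffAt ℝ m f x) (hg : ContDiffAt ℝ m g x)
    (hk : k + 1 ≤ m) : ContDiffAt ℝ k (gradDot f g) x := by
  unfold _root_.gradDot
  exact ContDiffAt.sum fun i _ => (hf.partialD hk i).mul (hg.partialD hk i)

theorem ContDiffAt.coordLaplacian {m k : ℕ∞ω} (hf : ContDiffAt ℝ m f x) (hk : k + 1 + 1 ≤ m) :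
    ContDiffAt ℝ k (coordLaplacian f) x := by
  unfold _root_.coordLaplacian
  exact ContDiffAt.sum fun i _ => (hf.partialD hk i).partialD le_rfl i

theorem Filter.EventuallyEq.gradDot {f' g' : EuclideanSpace ℝ (Fin n) → ℝ} (hf : f =ᶠ[𝓝 x] f')
    (hg : g =ᶠ[𝓝 x] g') : gradDot f g =ᶠ[𝓝 x] gradDot f' g' := by
  have h1 := eventually_all.2 fun i => hf.partialD i
  have h2 := eventually_all.2 fun i => hg.partialD i
  filter_upwards [h1, h2] with y h1 h2
  simp [_root_.gradDot, h1, h2]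

theorem Filter.EventuallyEq.coordLaplacian (hf : f =ᶠ[𝓝 x] g) :
    coordLaplacian f =ᶠ[𝓝 x] coordLaplacian g := by
  have h1 := eventually_all.2 fun i => (hf.partialD i).partialD i
  filter_upwards [h1] with y h1
  simp [_root_.coordLaplacian, h1]

theorem partialD_add (hf : DifferentiableAt ℝ f x) (hg : DifferentiableAt ℝ g x) (i : Fin n) :
    partialD i (fun y => f y + g y) x = partialD i f x + partialD i g x := by
  simp [partialD, fderiv_fun_add hf hg]

theorem partialD_mul (hf : DifferentiableAt ℝ f x) (hg : DifferentiableAt ℝ g x) (i : Fin n) :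
    partialD i (fun y => f y * g y) x = f x * partialD i g x + g x * partialD i f x := by
  simp [partialD, fderiv_fun_mul hf hg]

theorem partialD_const_mul (hf : DifferentiableAt ℝ f x) (c : ℝ) (i : Fin n) :
    partialD i (fun y => c * f y) x = c * partialD i f x := by
  simp [partialD, fderiv_const_mul hf]

theorem partialD_sum {ι : Type*} {s : Finset ι} {u : ι → EuclideanSpace ℝ (Fin n) → ℝ}
    (hu : ∀ j ∈ s, DifferentiableAt ℝ (u j) x) (i : Fin n) :
    partialD i (fun y => ∑ j ∈ s, u j y) x = ∑ j ∈ s, partialD i (u j) x := by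
  simp [partialD, fderiv_fun_sum hu]

theorem gradDot_add (hf : DifferentiableAt ℝ f x) (hg : DifferentiableAt ℝ g x)
    (h : EuclideanSpace ℝ (Fin n) → ℝ) :
    gradDot (fun y => f y + g y) h x = gradDot f h x + gradDot g h x := by
  simp [gradDot, partialD_add hf hg, add_mul, Finset.sum_add_distrib]

theorem gradDot_mul (hf : DifferentiableAt ℝ f x) (hg : DifferentiableAt ℝ g x)
    (h : EuclideanSpace ℝ (Fin n) → ℝ) :
    gradDot (fun y => f y * g y) h x = f x * gradDot g h x + g x * gradDot f h x := by
  simp [gradDot, partialD_mul hf hg, add_mul, Finset.sum_add_distrib, Finset.mul_sum, mul_assoc]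

theorem gradDot_const_mul (hf : DifferentiableAt ℝ f x) (c : ℝ)
    (h : EuclideanSpace ℝ (Fin n) → ℝ) :
    gradDot (fun y => c * f y) h x = c * gradDot f h x := by
  simp [gradDot, partialD_const_mul hf, Finset.mul_sum, mul_assoc]

theorem gradDot_gradDot (hf : ContDiffAt ℝ 2 f x) (hg : ContDiffAt ℝ 2 g x)
    (h : EuclideanSpace ℝ (Fin n) → ℝ) :
    gradDot (gradDot f g) h x = hessDot f h g x + hessDot g h f x := by
  have e (u : EuclideanSpace ℝ (Fin n) → ℝ) (hu : ContDiffAt ℝ 2 u x) (j : Fin n) :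
      DifferentiableAt ℝ (partialD j u) x :=
    (hu.partialD (k := 1) (by norm_num) j).differentiableAt one_ne_zero
  have key (i : Fin n) : partialD i (gradDot f g) x =
      ∑ j, (partialD j f x * partialD i (partialD j g) x
        + partialD j g x * partialD i (partialD j f) x) := by
    change partialD i (fun y => ∑ j, partialD j f y * partialD j g y) x = _
    rw [partialD_sum (u := fun j y => partialD j f y * partialD j g y)
      fun j _ => (e f hf j).mul (e g hg j)]
    exact Finset.sum_congr rfl fun j _ => partialD_mul (e f hf j) (e g hg j) i
  unfold hessDot
  change ∑ i, partialD i (gradDot f g) x * partialD i h x = _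
  simp only [key, Finset.sum_mul, ← Finset.sum_add_distrib]
  refine Finset.sum_congr rfl fun i _ => Finset.sum_congr rfl fun j _ => ?_
  ring

theorem sum_partialD_mul_partialD (hf : DifferentiableAt ℝ f x) (hg : ContDiffAt ℝ 2 g x) :
    ∑ i, partialD i (fun y => f y * partialD i g y) x =
      gradDot f g x + f x * coordLaplacian g x := by
  simp only [gradDot, coordLaplacian, Finset.mul_sum, ← Finset.sum_add_distrib]
  refine Finset.sum_congr rfl fun i _ => ?_
  rw [partialD_mul hf ((hg.partialD (k := 1) (by norm_num) i).differentiableAt one_ne_zero)]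
  ring

end PartialDerivatives

/-! ### The pointwise Carleman inequality. -/

section Carleman

variable {n : ℕ} {d a w v : EuclideanSpace ℝ (Fin n) → ℝ} {x : EuclideanSpace ℝ (Fin n)}

/-- The divergence-form part of the Carleman identity with weight `d` and multiplier `a`. -/
noncomputable def carlemanField (d a w : EuclideanSpace ℝ (Fin n) → ℝ) (τ : ℝ) (i : Fin n)
    (x : EuclideanSpace ℝ (Fin n)) : ℝ :=
  (-4 * τ * gradDot d w x + (-2 * τ * (coordLaplacian d x * w x) + -4 * τ * (a x * w x)))
      * partialD i w x
    + (2 * τ * gradDot w w x + -2 * τ ^ 3 * (gradDot d d x * (w x * w x))) * partialD i d x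

/-- The field is arranged so that two pairs cancel in its divergence: the Hessian of $w$ evaluated
at $(\nabla d,\nabla w)$, coming from $\nabla(\nabla d\cdot\nabla w)$ and from $\nabla|\nabla w|^2$,
and the terms $\Delta d\,|\nabla w|^2$. Only the Hessian of $d$, the cross term $2SA$ and
lower-order terms survive. -/
theorem sum_partialD_carlemanField (hd : ContDiffAt ℝ 3 d x) (ha : ContDiffAt ℝ 1 a x)
    (hw : ContDiffAt ℝ 2 w x) (τ : ℝ) :
    ∑ i, partialD i (carlemanField d a w τ i) x =
      -4 * τ * hessDot d w w x - 4 * τ * gradDot d w x * coordLaplacian w x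
      - 2 * τ * (w x * gradDot (coordLaplacian d) w x
        + coordLaplacian d x * w x * coordLaplacian w x)
      - 2 * τ ^ 3 * (2 * hessDot d d d x * w x ^ 2 + 2 * gradDot d d x * w x * gradDot d w x
        + gradDot d d x * w x ^ 2 * coordLaplacian d x)
      - 4 * τ * (w x * gradDot a w x + a x * gradDot w w x + a x * w x * coordLaplacian w x) := by
  have hd2 : ContDiffAt ℝ 2 d x := hd.of_le (by norm_num)
  have da := ha.differentiableAt one_ne_zero
  have dw := hw.differentiableAt two_ne_zero
  have dl : DifferentiableAt ℝ (coordLaplacian d) x :=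
    (hd.coordLaplacian (k := 1) (by norm_num)).differentiableAt one_ne_zero
  have ddw : DifferentiableAt ℝ (gradDot d w) x :=
    (hd2.gradDot hw (k := 1) (by norm_num)).differentiableAt one_ne_zero
  have dww : DifferentiableAt ℝ (gradDot w w) x :=
    (hw.gradDot hw (k := 1) (by norm_num)).differentiableAt one_ne_zero
  have ddd : DifferentiableAt ℝ (gradDot d d) x :=
    (hd2.gradDot hd2 (k := 1) (by norm_num)).differentiableAt one_ne_zero
  have pd (u : EuclideanSpace ℝ (Fin n) → ℝ) (hu : ContDiffAt ℝ 2 u x) (i : Fin n) :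
      DifferentiableAt ℝ (partialD i u) x :=
    (hu.partialD (k := 1) (by norm_num) i).differentiableAt one_ne_zero
  have dlw := dl.fun_mul dw
  have daw := da.fun_mul dw
  have dsq := dw.fun_mul dw
  have dN := ddd.fun_mul dsq
  have dφ := (ddw.const_mul (-4 * τ)).fun_add ((dlw.const_mul (-2 * τ)).fun_add
    (daw.const_mul (-4 * τ)))
  have dψ := (dww.const_mul (2 * τ)).fun_add (dN.const_mul (-2 * τ ^ 3))
  have e (i : Fin n) := partialD_add (dφ.fun_mul (pd w hw i)) (dψ.fun_mul (pd d hd2 i)) i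
  unfold carlemanField
  simp only [e, Finset.sum_add_distrib]
  rw [sum_partialD_mul_partialD dφ hw, sum_partialD_mul_partialD dψ hd2,
    gradDot_add (ddw.const_mul _) ((dlw.const_mul _).fun_add (daw.const_mul _)),
    gradDot_add (dlw.const_mul _) (daw.const_mul _), gradDot_add (dww.const_mul _) (dN.const_mul _),
    gradDot_const_mul ddw, gradDot_const_mul dlw, gradDot_const_mul daw, gradDot_const_mul dww,
    gradDot_const_mul dN, gradDot_mul dl dw, gradDot_mul da dw, gradDot_mul ddd dsq,
    gradDot_mul dw dw, gradDot_gradDot hd2 hw, gradDot_gradDot hw hw, gradDot_gradDot hd2 hd2,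
    hessDot_comm hw w d, gradDot_comm w d]
  ring

/-- The hypotheses on the weight `d`, with the auxiliary multiplier `a` and vector field `b`, at a
point at which they lead to a Carleman estimate. -/
structure IsCarlemanWeightAt (d a : EuclideanSpace ℝ (Fin n) → ℝ)
    (b : EuclideanSpace ℝ (Fin n) → Fin n → ℝ) (c M : ℝ) (x : EuclideanSpace ℝ (Fin n)) :
    Prop where
  contDiffAt : ContDiffAt ℝ 3 d x
  contDiffAt_mul : ContDiffAt ℝ 1 a x
  convex : ∀ X : Fin n → ℝ, c * ∑ i, X i ^ 2 ≤
    ∑ i, ∑ j, partialD i (partialD j d) x * X i * X j + a x * ∑ i, X i ^ 2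
      - 2 * (∑ i, b x i * X i) * ∑ i, partialD i d x * X i
  convex_grad : c + a x * gradDot d d x ≤ hessDot d d d x
  mul_bound : a x ^ 2 ≤ M ^ 2
  lap_bound : coordLaplacian d x ^ 2 ≤ M ^ 2
  field_bound : ∑ i, b x i ^ 2 ≤ M ^ 2
  grad_mul_bound : gradDot a a x ≤ M ^ 2
  grad_lap_bound : gradDot (coordLaplacian d) (coordLaplacian d) x ≤ M ^ 2
  grad_bound : gradDot d d x ≤ M ^ 2

theorem gradDot_sq_le (f g : EuclideanSpace ℝ (Fin n) → ℝ) :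
    gradDot f g x ^ 2 ≤ gradDot f f x * gradDot g g x := by
  have := Finset.sum_mul_sq_le_sq_mul_sq Finset.univ (fun i => partialD i f x)
    (fun i => partialD i g x)
  simpa [gradDot, sq] using this

/-- The algebra behind the pointwise estimate, with each geometric quantity replaced by a real
number: `p` is $|\nabla w|^2$, `q` is $\nabla d\cdot\nabla w$, `N` is $|\nabla d|^2$, `H` and `Hd`
are the Hessian of $d$ at $\nabla w$ and at $\nabla d$. Convexity gives $4c\tau p+4c\tau^3w^2$; one
quarter is kept and the rest dominates the errors. -/
theorem carleman_quadratic_inequality {w p N Lw Ld q H Hd β α κ a c τ M : ℝ}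
    (hp : 0 ≤ p) (hτ : 0 ≤ τ) (hH : c * p ≤ H + a * p - 2 * β * q) (hHd : c + a * N ≤ Hd)
    (ha : a ^ 2 ≤ M ^ 2) (hL : Ld ^ 2 ≤ M ^ 2) (hβ : β ^ 2 ≤ M ^ 2 * p) (hα : α ^ 2 ≤ M ^ 2 * p)
    (hκ : κ ^ 2 ≤ M ^ 2 * p) (hτc : 13 * M ^ 2 + 3 ≤ c * τ) :
    -4 * τ * H - 4 * τ * q * Lw - 2 * τ * (w * κ + Ld * w * Lw)
      - 2 * τ ^ 3 * (2 * Hd * w ^ 2 + 2 * N * w * q + N * w ^ 2 * Ld)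
      - 4 * τ * (w * α + a * p + a * w * Lw) + (c * τ * p + c * τ ^ 3 * w ^ 2)
      ≤ (Lw + τ ^ 2 * N * w - 2 * τ * q - τ * Ld * w) ^ 2 := by
  have e1 := mul_le_mul_of_nonneg_left hH (by positivity : 0 ≤ 4 * τ)
  have e2 := mul_le_mul_of_nonneg_left hHd (by positivity : 0 ≤ 4 * τ ^ 3 * w ^ 2)
  have e3 := mul_le_mul_of_nonneg_right hτc hp
  have e4 := mul_le_mul_of_nonneg_right hτc (by positivity : 0 ≤ τ ^ 2 * w ^ 2)
  -- Half of $S^2$ absorbs the multiplier term $4\tau awS$, and half of $A^2$ absorbs $-8\tau\beta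
  -- q$. With Young's inequality for the remaining products, the errors add up to at most $13M^2p$
  -- and $(10M^2+3)\tau^2w^2$, which explains the threshold in `hτc`.
  have s1 := sq_nonneg ((Lw + τ ^ 2 * N * w) + 4 * (τ * a * w))
  have s2 := sq_nonneg ((-2 * τ * q - τ * Ld * w) - 4 * β)
  have s3 := sq_nonneg (β - τ * Ld * w)
  have s4 := sq_nonneg (α + τ * w)
  have s5 := sq_nonneg (κ + τ * w)
  have m1 := mul_le_mul_of_nonneg_right ha (by positivity : 0 ≤ τ ^ 2 * w ^ 2)
  have m2 := mul_le_mul_of_nonneg_right hL (by positivity : 0 ≤ τ ^ 2 * w ^ 2)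
  have s6 := sq_nonneg (Lw + τ ^ 2 * N * w)
  have s7 := sq_nonneg (-2 * τ * q - τ * Ld * w)
  have m3 : 0 ≤ M ^ 2 * p := by positivity
  have m4 : 0 ≤ M ^ 2 * (τ ^ 2 * w ^ 2) := by positivity
  have m5 : 0 ≤ τ ^ 2 * w ^ 2 := by positivity
  linarith

theorem IsCarlemanWeightAt.sq_conjugated_ge {b : EuclideanSpace ℝ (Fin n) → Fin n → ℝ} {c M τ : ℝ}
    (h : IsCarlemanWeightAt d a b c M x) (hw : ContDiffAt ℝ 2 w x) (hτ : 0 ≤ τ)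
    (hτc : 13 * M ^ 2 + 3 ≤ c * τ) :
    ∑ i, partialD i (carlemanField d a w τ i) x
        + (c * τ * gradDot w w x + c * τ ^ 3 * w x ^ 2) ≤
      (coordLaplacian w x + τ ^ 2 * gradDot d d x * w x - 2 * τ * gradDot d w x
        - τ * coordLaplacian d x * w x) ^ 2 := by
  rw [sum_partialD_carlemanField h.contDiffAt h.contDiffAt_mul hw]
  have hp : 0 ≤ gradDot w w x := gradDot_self_nonneg
  have hX : ∑ i, partialD i w x ^ 2 = gradDot w w x := by simp [gradDot, sq]
  refine carleman_quadratic_inequality (β := ∑ i, b x i * partialD i w x) hp hτ ?_ h.convex_grad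
    h.mul_bound h.lap_bound ?_ ?_ ?_ hτc
  · have := h.convex fun i => partialD i w x
    rw [hX] at this
    exact this
  · refine (Finset.sum_mul_sq_le_sq_mul_sq _ _ _).trans ?_
    rw [hX]
    exact mul_le_mul_of_nonneg_right h.field_bound hp
  · exact (gradDot_sq_le _ _).trans (mul_le_mul_of_nonneg_right h.grad_mul_bound hp)
  · exact (gradDot_sq_le _ _).trans (mul_le_mul_of_nonneg_right h.grad_lap_bound hp)

end Carleman

/-! ### Conjugation by the exponential weight and integration over test functions. -/

section CarlemanIntegral

variable {n : ℕ} {d a f g v : EuclideanSpace ℝ (Fin n) → ℝ} {x : EuclideanSpace ℝ (Fin n)}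

theorem coordLaplacian_mul (hf : ContDiffAt ℝ 2 f x) (hg : ContDiffAt ℝ 2 g x) :
    coordLaplacian (fun y => f y * g y) x =
      f x * coordLaplacian g x + 2 * gradDot f g x + g x * coordLaplacian f x := by
  have pd (u : EuclideanSpace ℝ (Fin n) → ℝ) (hu : ContDiffAt ℝ 2 u x) (i : Fin n) :
      DifferentiableAt ℝ (partialD i u) x :=
    (hu.partialD (k := 1) (by norm_num) i).differentiableAt one_ne_zero
  have df := hf.differentiableAt two_ne_zero
  have dg := hg.differentiableAt two_ne_zero
  have key (i : Fin n) : partialD i (partialD i (fun y => f y * g y)) x =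
      f x * partialD i (partialD i g) x + 2 * (partialD i f x * partialD i g x)
        + g x * partialD i (partialD i f) x := by
    have h1 : partialD i (fun y => f y * g y) =ᶠ[𝓝 x]
        fun y => f y * partialD i g y + g y * partialD i f y := by
      filter_upwards [hf.eventually (by simp), hg.eventually (by simp)] with y h1 h2
      exact partialD_mul (h1.differentiableAt two_ne_zero) (h2.differentiableAt two_ne_zero) i
    rw [(h1.partialD i).eq_of_nhds,
      partialD_add (df.fun_mul (pd g hg i)) (dg.fun_mul (pd f hf i)),
      partialD_mul df (pd g hg i), partialD_mul dg (pd f hf i)]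
    ring
  unfold coordLaplacian gradDot
  simp only [key, Finset.sum_add_distrib, Finset.mul_sum]

theorem partialD_exp_mul (hd : DifferentiableAt ℝ d x) (τ : ℝ) (i : Fin n) :
    partialD i (fun y => Real.exp (τ * d y)) x =
      τ * (Real.exp (τ * d x) * partialD i d x) := by
  have := ((hd.hasFDerivAt.const_mul τ).exp).fderiv
  simp only [partialD, this]
  simp
  ring

theorem gradDot_exp_mul (hd : DifferentiableAt ℝ d x) (τ : ℝ)
    (g : EuclideanSpace ℝ (Fin n) → ℝ) :
    gradDot (fun y => Real.exp (τ * d y)) g x =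
      τ * (Real.exp (τ * d x) * gradDot d g x) := by
  simp only [gradDot, partialD_exp_mul hd, Finset.mul_sum, mul_assoc]

theorem coordLaplacian_exp_mul (hd : ContDiffAt ℝ 2 d x) (τ : ℝ) :
    coordLaplacian (fun y => Real.exp (τ * d y)) x =
      Real.exp (τ * d x) * (τ * coordLaplacian d x + τ ^ 2 * gradDot d d x) := by
  have dd := hd.differentiableAt two_ne_zero
  have pd (i : Fin n) : DifferentiableAt ℝ (partialD i d) x :=
    (hd.partialD (k := 1) (by norm_num) i).differentiableAt one_ne_zero
  have de : DifferentiableAt ℝ (fun y => Real.exp (τ * d y)) x := (dd.const_mul τ).exp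
  have key (i : Fin n) : partialD i (partialD i (fun y => Real.exp (τ * d y))) x =
      Real.exp (τ * d x) * (τ * partialD i (partialD i d) x
        + τ ^ 2 * (partialD i d x * partialD i d x)) := by
    have h1 : partialD i (fun y => Real.exp (τ * d y)) =ᶠ[𝓝 x]
        fun y => τ * (Real.exp (τ * d y) * partialD i d y) := by
      filter_upwards [hd.eventually (by simp)] with y h1
      exact partialD_exp_mul (h1.differentiableAt two_ne_zero) τ i
    rw [(h1.partialD i).eq_of_nhds, partialD_const_mul (de.fun_mul (pd i)),
      partialD_mul de (pd i), partialD_exp_mul dd]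
    ring
  unfold coordLaplacian gradDot
  simp only [key, mul_add, Finset.sum_add_distrib, Finset.mul_sum]

/-- Product rule for $w=e^{\tau d}v$: the conjugated operator $e^{\tau d}\Delta e^{-\tau d}$ applied
to $w$, which is the expression squared in the pointwise inequality. -/
theorem conjugated_laplacian_eq (hd : ContDiffAt ℝ 2 d x) (hv : ContDiffAt ℝ 2 v x) (τ : ℝ) :
    coordLaplacian (fun y => Real.exp (τ * d y) * v y) x
        + τ ^ 2 * gradDot d d x * (Real.exp (τ * d x) * v x)
        - 2 * τ * gradDot d (fun y => Real.exp (τ * d y) * v y) x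
        - τ * coordLaplacian d x * (Real.exp (τ * d x) * v x) =
      Real.exp (τ * d x) * coordLaplacian v x := by
  have he : ContDiffAt ℝ 2 (fun y => Real.exp (τ * d y)) x := (contDiffAt_const.mul hd).exp
  have dd := hd.differentiableAt two_ne_zero
  rw [coordLaplacian_mul he hv, coordLaplacian_exp_mul hd,
    gradDot_comm d (fun y => Real.exp (τ * d y) * v y),
    gradDot_mul (he.differentiableAt two_ne_zero) (hv.differentiableAt two_ne_zero),
    gradDot_exp_mul dd, gradDot_exp_mul dd, gradDot_comm v d]
  ring

theorem exp_mul_gradDot_le (hd : DifferentiableAt ℝ d x) (hv : DifferentiableAt ℝ v x) (τ : ℝ) :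
    Real.exp (2 * τ * d x) * gradDot v v x ≤
      2 * gradDot (fun y => Real.exp (τ * d y) * v y) (fun y => Real.exp (τ * d y) * v y) x
        + 2 * τ ^ 2 * gradDot d d x * (Real.exp (τ * d x) * v x) ^ 2 := by
  have he : DifferentiableAt ℝ (fun y => Real.exp (τ * d y)) x := (hd.const_mul τ).exp
  have e2 : Real.exp (2 * τ * d x) = Real.exp (τ * d x) ^ 2 := by
    rw [← Real.exp_nat_mul]; congr 1; push_cast; ring
  simp only [gradDot, partialD_mul he hv, partialD_exp_mul hd, e2, Finset.mul_sum, Finset.sum_mul,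
    ← Finset.sum_add_distrib]
  refine Finset.sum_le_sum fun i _ => ?_
  -- For each coordinate, right side minus left side is exactly this square.
  nlinarith [sq_nonneg (Real.exp (τ * d x) * (partialD i v x + 2 * τ * v x * partialD i d x))]

/-- The weight is regular only on $U$, but near any point outside the support of the other factor
the product is zero. -/
theorem contDiff_mul_of_tsupport_subset {U : Set (EuclideanSpace ℝ (Fin n))} {k : ℕ∞ω}
    (hf : ∀ x ∈ U, ContDiffAt ℝ k f x) (hg : ContDiff ℝ k g) (hU : tsupport g ⊆ U) :
    ContDiff ℝ k (fun x => f x * g x) := by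
  refine contDiff_iff_contDiffAt.2 fun x => ?_
  by_cases hx : x ∈ tsupport g
  · exact (hf x (hU hx)).mul hg.contDiffAt
  · refine (contDiffAt_const (c := (0 : ℝ))).congr_of_eventuallyEq ?_
    filter_upwards [notMem_tsupport_iff_eventuallyEq.1 hx] with y hy
    simp [hy]

theorem carlemanField_eventuallyEq_zero (hv : v =ᶠ[𝓝 x] 0) (τ : ℝ) (i : Fin n) :
    carlemanField d a v τ i =ᶠ[𝓝 x] 0 := by
  have h := eventually_all.2 fun i => hv.partialD_zero i
  filter_upwards [hv, h] with y h1 h2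
  simp [carlemanField, gradDot, h1, h2]

/-- A compactly supported $C^1$ field has divergence of integral zero. Three derivatives of $d$ are
required because the field contains $\Delta d$. -/
theorem integral_sum_partialD_carlemanField {U : Set (EuclideanSpace ℝ (Fin n))}
    (hd : ∀ x ∈ U, ContDiffAt ℝ 3 d x) (ha : ∀ x ∈ U, ContDiffAt ℝ 1 a x)
    (hv : ContDiff ℝ 2 v) (hc : HasCompactSupport v) (hU : tsupport v ⊆ U) (τ : ℝ) :
    Integrable (fun x => ∑ i, partialD i (carlemanField d a v τ i) x) ∧
      ∫ x, ∑ i, partialD i (carlemanField d a v τ i) x = 0 := by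
  have hB (i : Fin n) : ContDiff ℝ 1 (carlemanField d a v τ i) := by
    refine contDiff_iff_contDiffAt.2 fun x => ?_
    by_cases hx : x ∈ tsupport v
    · have h3 := hd x (hU hx)
      have h2 : ContDiffAt ℝ 2 d x := h3.of_le (by norm_num)
      have w2 : ContDiffAt ℝ 2 v x := hv.contDiffAt
      have w1 : ContDiffAt ℝ 1 v x := w2.of_le (by norm_num)
      have a1 := ha x (hU hx)
      have := h3.coordLaplacian (k := 1) (by norm_num)
      have := h2.gradDot w2 (k := 1) (by norm_num)
      have := h2.gradDot h2 (k := 1) (by norm_num)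
      have := w2.gradDot w2 (k := 1) (by norm_num)
      have := w2.partialD (k := 1) (by norm_num) i
      have := h2.partialD (k := 1) (by norm_num) i
      unfold carlemanField
      fun_prop
    · exact (contDiffAt_const (c := (0 : ℝ))).congr_of_eventuallyEq
        (carlemanField_eventuallyEq_zero (notMem_tsupport_iff_eventuallyEq.1 hx) τ i)
  have hBc (i : Fin n) : HasCompactSupport (carlemanField d a v τ i) :=
    HasCompactSupport.intro hc fun x hx => (carlemanField_eventuallyEq_zero
      (notMem_tsupport_iff_eventuallyEq.1 hx) τ i).eq_of_nhds
  have hI (i : Fin n) : Integrable (partialD i (carlemanField d a v τ i)) :=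
    (((hB i).partialD (k := 0) (by norm_num) i).continuous).integrable_of_hasCompactSupport
      ((hBc i).partialD i)
  refine ⟨integrable_finsetSum _ fun i _ => hI i, ?_⟩
  rw [integral_finsetSum _ fun i _ => hI i]
  exact Finset.sum_eq_zero fun i _ => integral_partialD_eq_zero (hB i) (hBc i) i

/-- The Carleman estimate for the Euclidean Laplacian on test functions. -/
theorem carleman_estimate {U : Set (EuclideanSpace ℝ (Fin n))}
    {b : EuclideanSpace ℝ (Fin n) → Fin n → ℝ} {c M τ : ℝ} (hc : 0 < c)
    (h : ∀ x ∈ U, IsCarlemanWeightAt d a b c M x) (hτ : 1 ≤ τ) (hτc : 13 * M ^ 2 + 3 ≤ c * τ)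
    (hv : IsTestFunction U v) :
    τ * c * ∫ x, Real.exp (2 * τ * d x) * (gradDot v v x + v x ^ 2) ≤
      (2 * M ^ 2 + 3) * ∫ x, Real.exp (2 * τ * d x) * coordLaplacian v x ^ 2 := by
  have hv2 : ContDiff ℝ 2 v := hv.smooth.of_le (WithTop.coe_le_coe.2 le_top)
  set w := fun y => Real.exp (τ * d y) * v y with hw_def
  have hw : ContDiff ℝ 2 w := contDiff_mul_of_tsupport_subset
    (fun x hx => (contDiffAt_const.mul ((h x hx).contDiffAt.of_le (by norm_num))).exp)
    hv2 hv.support_subset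
  have hwv {x : EuclideanSpace ℝ (Fin n)} (hx : x ∉ tsupport v) : w =ᶠ[𝓝 x] 0 := by
    filter_upwards [notMem_tsupport_iff_eventuallyEq.1 hx] with y hy
    simp [w, hy]
  have hwt : tsupport w ⊆ tsupport v := fun x hx => by
    by_contra hxv
    exact notMem_tsupport_iff_eventuallyEq.2 (hwv hxv) hx
  have hwc : HasCompactSupport w := hv.compactSupport.of_isClosed_subset (isClosed_tsupport _) hwt
  obtain ⟨hBI, hB0⟩ := integral_sum_partialD_carlemanField (fun x hx => (h x hx).contDiffAt)
    (fun x hx => (h x hx).contDiffAt_mul) hw hwc (hwt.trans hv.support_subset) τ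
  have zero_jet {x : EuclideanSpace ℝ (Fin n)} (hx : x ∉ tsupport v) :
      v x = 0 ∧ gradDot v v x = 0 ∧ coordLaplacian v x = 0 := by
    have h0 := notMem_tsupport_iff_eventuallyEq.1 hx
    refine ⟨h0.eq_of_nhds, ?_, ?_⟩
    · exact Finset.sum_eq_zero fun i _ => by simp [(h0.partialD_zero i).eq_of_nhds]
    · exact Finset.sum_eq_zero fun i _ => ((h0.partialD_zero i).partialD_zero i).eq_of_nhds
  have integrable_of {u : EuclideanSpace ℝ (Fin n) → ℝ} (hu : Continuous u)
      (h0 : ∀ x, x ∉ tsupport v → u x = 0) :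
      Integrable fun x => Real.exp (2 * τ * d x) * u x := by
    have hut : tsupport u ⊆ tsupport v := closure_minimal
      (fun x hx => by_contra fun hxv => hx (h0 x hxv)) (isClosed_tsupport _)
    have huc : HasCompactSupport u := hv.compactSupport.of_isClosed_subset (isClosed_tsupport _) hut
    refine Continuous.integrable_of_hasCompactSupport ?_ huc.mul_left
    exact (contDiff_mul_of_tsupport_subset (k := 0)
      (fun x hx => (contDiffAt_const.mul ((h x hx).contDiffAt.of_le (by norm_num))).exp)
      (contDiff_zero.2 hu) (hut.trans hv.support_subset)).continuous
  have cp (i : Fin n) : Continuous (partialD i v) :=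
    (hv2.partialD (k := 1) (by norm_num) i).continuous
  have cpp (i : Fin n) : Continuous (partialD i (partialD i v)) :=
    ((hv2.partialD (k := 1) (by norm_num) i).partialD (k := 0) (by norm_num) i).continuous
  have cg : Continuous (gradDot v v) := by
    unfold gradDot; fun_prop
  have cl : Continuous (coordLaplacian v) := by
    unfold coordLaplacian; fun_prop
  have I1 : Integrable fun x => Real.exp (2 * τ * d x) * (gradDot v v x + v x ^ 2) :=
    integrable_of (cg.add (hv2.continuous.pow 2)) fun x hx => by simp [zero_jet hx]
  have I2 : Integrable fun x => Real.exp (2 * τ * d x) * coordLaplacian v x ^ 2 :=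
    integrable_of (cl.pow 2) fun x hx => by simp [zero_jet hx]
  have key (x : EuclideanSpace ℝ (Fin n)) :
      τ * c * (Real.exp (2 * τ * d x) * (gradDot v v x + v x ^ 2)) ≤
        (2 * M ^ 2 + 3) * (Real.exp (2 * τ * d x) * coordLaplacian v x ^ 2
          - ∑ i, partialD i (carlemanField d a w τ i) x) := by
    by_cases hx : x ∈ tsupport v
    · have hxU := h x (hv.support_subset hx)
      have hd2 : ContDiffAt ℝ 2 d x := hxU.contDiffAt.of_le (by norm_num)
      have k1 := hxU.sq_conjugated_ge hw.contDiffAt (by linarith) hτc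
      rw [conjugated_laplacian_eq hd2 hv2.contDiffAt] at k1
      have k2 := exp_mul_gradDot_le (hd2.differentiableAt two_ne_zero)
        (hv2.differentiable two_ne_zero x) τ
      have e2 : Real.exp (2 * τ * d x) = Real.exp (τ * d x) ^ 2 := by
        rw [← Real.exp_nat_mul]; congr 1; push_cast; ring
      have hp : 0 ≤ gradDot w w x := gradDot_self_nonneg
      have hwx : w x ^ 2 = Real.exp (2 * τ * d x) * v x ^ 2 := by rw [e2, hw_def]; ring
      rw [show (Real.exp (τ * d x) * coordLaplacian v x) ^ 2 =
        Real.exp (2 * τ * d x) * coordLaplacian v x ^ 2 by rw [e2, mul_pow]] at k1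
      change _ ≤ 2 * gradDot w w x + 2 * τ ^ 2 * gradDot d d x * (w x) ^ 2 at k2
      have k3 : gradDot d d x * (τ ^ 2 * w x ^ 2) ≤ M ^ 2 * (τ ^ 2 * w x ^ 2) :=
        mul_le_mul_of_nonneg_right hxU.grad_bound (by positivity)
      have k4 : 1 * w x ^ 2 ≤ τ ^ 2 * w x ^ 2 :=
        mul_le_mul_of_nonneg_right (by nlinarith) (by positivity)
      -- Return from $w$ to $v$: $e^{\tau d}\nabla v=\nabla w-\tau w\nabla d$ costs $2|\nabla
      -- w|^2+2M^2\tau^2w^2$, and $w^2\le\tau^2w^2$ because $\tau\ge1$.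
      have k5 : Real.exp (2 * τ * d x) * (gradDot v v x + v x ^ 2) ≤
          (2 * M ^ 2 + 3) * (gradDot w w x + τ ^ 2 * w x ^ 2) := by
        have : 0 ≤ M ^ 2 * gradDot w w x := by positivity
        have : 0 ≤ τ ^ 2 * w x ^ 2 := by positivity
        rw [mul_add, ← hwx]
        linarith
      have k6 := mul_le_mul_of_nonneg_left k5 (by positivity : 0 ≤ τ * c)
      have k7 := mul_le_mul_of_nonneg_left k1 (by positivity : 0 ≤ 2 * M ^ 2 + 3)
      linarith
    · have : ∀ i, partialD i (carlemanField d a w τ i) x = 0 := fun i =>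
        ((carlemanField_eventuallyEq_zero (hwv hx) τ i).partialD_zero i).eq_of_nhds
      simp [zero_jet hx, this]
  calc _ = ∫ x, τ * c * (Real.exp (2 * τ * d x) * (gradDot v v x + v x ^ 2)) :=
        (integral_const_mul _ _).symm
    _ ≤ ∫ x, (2 * M ^ 2 + 3) * (Real.exp (2 * τ * d x) * coordLaplacian v x ^ 2
          - ∑ i, partialD i (carlemanField d a w τ i) x) :=
        integral_mono (I1.const_mul _) ((I2.sub hBI).const_mul _) key
    _ = _ := by rw [integral_const_mul, integral_sub I2 hBI, hB0, sub_zero]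

end CarlemanIntegral

/-! ### The Levi-Civita Hessian of a conformally flat metric. -/

section ConformalMetric

variable {n : ℕ} {D d : EuclideanSpace ℝ (Fin n) → ℝ} {x : EuclideanSpace ℝ (Fin n)}

theorem conformalMetric_apply (D : EuclideanSpace ℝ (Fin n) → ℝ) (x : EuclideanSpace ℝ (Fin n))
    (i j : Fin n) : conformalMetric D x i j = (D x)⁻¹ * if i = j then 1 else 0 := by
  simp [conformalMetric, Matrix.one_apply]

theorem conformalMetric_inv (hD : D x ≠ 0) :
    (conformalMetric D x)⁻¹ = D x • (1 : Matrix (Fin n) (Fin n) ℝ) := by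
  refine Matrix.inv_eq_right_inv ?_
  simp [conformalMetric, smul_smul, mul_inv_cancel₀ hD]

theorem gGrad_conformalMetric (hD : D x ≠ 0) (f : EuclideanSpace ℝ (Fin n) → ℝ) (k : Fin n) :
    gGrad (conformalMetric D) f x k = D x * partialD k f x := by
  simp [gGrad, conformalMetric_inv hD, Matrix.one_apply]

theorem gInner_conformalMetric (X Y : Fin n → ℝ) :
    gInner (conformalMetric D) x X Y = (D x)⁻¹ * ∑ i, X i * Y i := by
  simp [gInner, conformalMetric_apply, Finset.mul_sum, mul_assoc]

theorem partialD_conformalMetric (hD : DifferentiableAt ℝ D x) (h0 : D x ≠ 0) (i j l : Fin n) :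
    partialD i (fun y => conformalMetric D y j l) x =
      if j = l then -(D x)⁻¹ ^ 2 * partialD i D x else 0 := by
  simp only [conformalMetric_apply]
  split_ifs
  · simp only [mul_one, partialD]
    have h : HasFDerivAt (fun y => (D y)⁻¹) _ x :=
      (hasDerivAt_inv h0).comp_hasFDerivAt x hD.hasFDerivAt
    rw [h.fderiv]
    simp
  · simp [partialD]

theorem christoffel_conformalMetric (hD : DifferentiableAt ℝ D x) (h0 : D x ≠ 0) (k i j : Fin n) :
    christoffel (conformalMetric D) x k i j =
      -(1 / 2) * (D x)⁻¹ * ((if j = k then partialD i D x else 0)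
        + (if i = k then partialD j D x else 0) - if i = j then partialD k D x else 0) := by
  simp only [christoffel, conformalMetric_inv h0, partialD_conformalMetric hD h0,
    Matrix.smul_apply, Matrix.one_apply, smul_eq_mul, mul_ite, mul_one, mul_zero, ite_mul, zero_mul,
    Finset.sum_ite_eq, Finset.mem_univ, if_true]
  split_ifs <;> field_simp <;> ring

/-- The factor $D$ in the Riemannian gradient cancels the factor $D^{-1}$ of the metric, leaving the
Euclidean Hessian; differentiating $D$ and the Christoffel symbols contribute the remaining
first-order terms, symmetric once paired with $X$ twice. -/
theorem gHess_conformalMetric (hD : ContDiffAt ℝ 1 D x) (h0 : D x ≠ 0) (hd : ContDiffAt ℝ 2 d x)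
    (X : Fin n → ℝ) :
    gHess (conformalMetric D) d x X X =
      ∑ i, ∑ j, partialD i (partialD j d) x * X i * X j
        + (D x)⁻¹ * (∑ i, partialD i D x * X i) * (∑ i, partialD i d x * X i)
        - (1 / 2) * (D x)⁻¹ * gradDot D d x * ∑ i, X i ^ 2 := by
  have dD := hD.differentiableAt one_ne_zero
  have pd (k : Fin n) : DifferentiableAt ℝ (partialD k d) x :=
    (hd.partialD (k := 1) (by norm_num) k).differentiableAt one_ne_zero
  have hgrad (i k : Fin n) : partialD i (fun y => gGrad (conformalMetric D) d y k) x =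
      D x * partialD i (partialD k d) x + partialD k d x * partialD i D x := by
    have : (fun y => gGrad (conformalMetric D) d y k) =ᶠ[𝓝 x] fun y => D y * partialD k d y := by
      filter_upwards [hD.continuousAt.eventually_ne h0] with y hy
      exact gGrad_conformalMetric hy d k
    rw [(this.partialD i).eq_of_nhds, partialD_mul dD (pd k)]
  have hchr (i k : Fin n) : ∑ j, christoffel (conformalMetric D) x k i j *
      gGrad (conformalMetric D) d x j = -(1 / 2) * (partialD i D x * partialD k d x
        + (if i = k then gradDot D d x else 0) - partialD k D x * partialD i d x) := by
    simp only [christoffel_conformalMetric dD h0, gGrad_conformalMetric h0, mul_assoc, sub_mul,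
      add_mul, mul_sub, mul_add, ite_mul, zero_mul, mul_ite, mul_zero, Finset.sum_sub_distrib,
      Finset.sum_add_distrib, Finset.sum_ite_eq, Finset.sum_ite_eq', Finset.mem_univ, if_true]
    split_ifs with h
    · rw [← Finset.mul_sum, ← Finset.mul_sum]
      have : ∑ i, partialD i D x * (D x * partialD i d x) = D x * gradDot D d x := by
        rw [gradDot, Finset.mul_sum]
        exact Finset.sum_congr rfl fun _ _ => by ring
      rw [this]
      field_simp
    · simp
      field_simp
  rw [gHess, gInner_conformalMetric]
  simp only [covDeriv, hgrad, hchr]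
  have hsym (k i : Fin n) : (D x)⁻¹ * (X i * (D x * partialD i (partialD k d) x
      + partialD k d x * partialD i D x + -(1 / 2) * (partialD i D x * partialD k d x
        + (if i = k then gradDot D d x else 0) - partialD k D x * partialD i d x)) * X k) =
      partialD i (partialD k d) x * X i * X k
      + ((1 / 2) * (D x)⁻¹ * ((partialD i D x * X i) * (partialD k d x * X k))
      + (1 / 2) * (D x)⁻¹ * ((partialD k D x * X k) * (partialD i d x * X i)))
      - if i = k then (1 / 2) * (D x)⁻¹ * gradDot D d x * X i ^ 2 else 0 := by
    split_ifs with h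
    · subst h; field_simp; ring
    · field_simp; ring
  have hcomm : ∑ k, (∑ i, partialD i (partialD k d) x * X i) * X k =
      ∑ i, ∑ j, partialD i (partialD j d) x * X i * X j := by
    simp only [Finset.sum_mul]
    exact Finset.sum_comm
  calc _ = ∑ k, ∑ i, (D x)⁻¹ * (X i * (D x * partialD i (partialD k d) x
      + partialD k d x * partialD i D x + -(1 / 2) * (partialD i D x * partialD k d x
        + (if i = k then gradDot D d x else 0) - partialD k D x * partialD i d x)) * X k) := by
        simp only [Finset.mul_sum, Finset.sum_mul]
    _ = _ := by
      simp only [hsym, Finset.sum_add_distrib, Finset.sum_sub_distrib, ← Finset.mul_sum,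
        Finset.sum_ite_eq', Finset.mem_univ, if_true, ← Finset.sum_mul]
      rw [hcomm]
      ring

end ConformalMetric

/-! ### Uniform bounds on derivatives. -/

section Bounds

/-- Near each point of the closure there is a local Taylor series whose terms are continuous up to
the boundary, hence locally bounded; on the open set they agree with the genuine derivatives by
uniqueness. Compactness makes the bound global, and no unique differentiability of the closure is
involved. -/
theorem ContDiffOn.exists_norm_iteratedFDeriv_le {E F : Type*} [NormedAddCommGroup E]
    [NormedSpace ℝ E] [NormedAddCommGroup F] [NormedSpace ℝ F] {Ω : Set E} {f : E → F} {m k : ℕ}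
    (hf : ContDiffOn ℝ m f (closure Ω)) (hΩ : IsOpen Ω) (hc : IsCompact (closure Ω)) (hk : k ≤ m) :
    ∃ C, ∀ x ∈ Ω, ‖iteratedFDeriv ℝ k f x‖ ≤ C := by
  have hloc : ∀ x ∈ closure Ω, ∃ t ∈ 𝓝[closure Ω] x,
      ∃ C, ∀ y ∈ t ∩ Ω, ‖iteratedFDeriv ℝ k f y‖ ≤ C := by
    intro x hx
    obtain ⟨u, hu, p, hp⟩ := contDiffWithinAt_nat.1 (hf x hx)
    rw [insert_eq_of_mem hx] at hu
    obtain ⟨o, ho, hxo, hou⟩ := mem_nhdsWithin.1 hu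
    have hxu : x ∈ u := hou ⟨hxo, hx⟩
    have hcont : ContinuousWithinAt (fun y => ‖p y k‖) u x :=
      (hp.cont k (by exact_mod_cast hk) x hxu).norm
    have h1 : ∀ᶠ y in 𝓝[u] x, ‖p y k‖ < ‖p x k‖ + 1 :=
      hcont.eventually (gt_mem_nhds (lt_add_one _))
    obtain ⟨o', ho', hxo', hou'⟩ := mem_nhdsWithin.1 h1
    refine ⟨o ∩ o' ∩ closure Ω, mem_nhdsWithin.2 ⟨o ∩ o', ho.inter ho', ⟨hxo, hxo'⟩, Subset.rfl⟩,
      ‖p x k‖ + 1, fun y hy => ?_⟩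
    have hyu : y ∈ u := hou ⟨hy.1.1.1, hy.1.2⟩
    have hsub : o ∩ Ω ⊆ u := fun z hz => hou ⟨hz.1, subset_closure hz.2⟩
    have hoo : IsOpen (o ∩ Ω) := ho.inter hΩ
    have hyo : y ∈ o ∩ Ω := ⟨hy.1.1.1, hy.2⟩
    have h2 := (hp.mono hsub).eq_iteratedFDerivWithin_of_uniqueDiffOn
      (by exact_mod_cast hk : (k : ℕ∞ω) ≤ m) hoo.uniqueDiffOn hyo
    rw [iteratedFDerivWithin_of_isOpen k hoo hyo] at h2
    rw [← h2]
    exact (hou' ⟨hy.1.1.2, hyu⟩).le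
  obtain ⟨C, hC⟩ := hc.induction_on (p := fun t => ∃ C, ∀ y ∈ t ∩ Ω, ‖iteratedFDeriv ℝ k f y‖ ≤ C)
    ⟨0, by simp⟩ (fun s t hst ⟨C, hC⟩ => ⟨C, fun y hy => hC y ⟨hst hy.1, hy.2⟩⟩)
    (fun s t ⟨C, hC⟩ ⟨C', hC'⟩ => ⟨max C C', fun y hy => hy.1.elim
      (fun h => (hC y ⟨h, hy.2⟩).trans (le_max_left _ _))
      (fun h => (hC' y ⟨h, hy.2⟩).trans (le_max_right _ _))⟩) hloc
  exact ⟨C, fun x hx => hC x ⟨subset_closure hx, hx⟩⟩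

variable {n : ℕ} {Ω : Set (EuclideanSpace ℝ (Fin n))} {f : EuclideanSpace ℝ (Fin n) → ℝ}
  {x : EuclideanSpace ℝ (Fin n)}

theorem partialD_iteratedFDeriv {k : ℕ} (hf : ContDiffAt ℝ (k + 1 : ℕ) f x) (i : Fin n)
    (v : Fin k → EuclideanSpace ℝ (Fin n)) :
    partialD i (fun y => iteratedFDeriv ℝ k f y v) x =
      iteratedFDeriv ℝ (k + 1) f x (Fin.cons (EuclideanSpace.single i 1) v) := by
  have h1 : DifferentiableAt ℝ (iteratedFDeriv ℝ k f) x :=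
    hf.differentiableAt_iteratedFDeriv (by exact_mod_cast Nat.lt_succ_self k)
  rw [iteratedFDeriv_succ_apply_left, partialD, fderiv_continuousMultilinear_apply_const_apply h1]
  simp

theorem exists_iteratedFDeriv_apply_le {m k : ℕ} (hf : ContDiffOn ℝ m f (closure Ω))
    (hΩ : IsOpen Ω) (hb : Bornology.IsBounded Ω) (hk : k ≤ m)
    (v : Fin k → EuclideanSpace ℝ (Fin n)) :
    ∃ C, ∀ x ∈ Ω, |iteratedFDeriv ℝ k f x v| ≤ C := by
  obtain ⟨C, hC⟩ := hf.exists_norm_iteratedFDeriv_le hΩ hb.isCompact_closure hk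
  refine ⟨C * ∏ i, ‖v i‖, fun x hx => ?_⟩
  exact ((iteratedFDeriv ℝ k f x).le_opNorm v).trans
    (mul_le_mul_of_nonneg_right (hC x hx) (by positivity))

theorem exists_partialD_bounds (hf : ContDiffOn ℝ 3 f (closure Ω)) (hΩ : IsOpen Ω)
    (hb : Bornology.IsBounded Ω) (i j k : Fin n) :
    ∃ C, ∀ x ∈ Ω, |partialD i f x| ≤ C ∧ |partialD i (partialD j f) x| ≤ C ∧
      |partialD i (partialD j (partialD k f)) x| ≤ C := by
  have hfx : ∀ x ∈ Ω, ContDiffAt ℝ 3 f x := fun x hx =>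
    hf.contDiffAt (mem_of_superset (hΩ.mem_nhds hx) subset_closure)
  have h1 (i : Fin n) : ∀ x ∈ Ω, partialD i f x =
      iteratedFDeriv ℝ 1 f x ![EuclideanSpace.single i 1] := fun x hx => by
    simp [partialD, iteratedFDeriv_one_apply]
  have h2 (i j : Fin n) : ∀ x ∈ Ω, partialD i (partialD j f) x =
      iteratedFDeriv ℝ 2 f x ![EuclideanSpace.single i 1, EuclideanSpace.single j 1] :=
      fun x hx => by
    have e : partialD j f =ᶠ[𝓝 x] _ := mem_of_superset (hΩ.mem_nhds hx) (h1 j)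
    rw [(e.partialD i).eq_of_nhds, partialD_iteratedFDeriv ((hfx x hx).of_le (by norm_num))]
    rfl
  have h3 : ∀ x ∈ Ω, partialD i (partialD j (partialD k f)) x =
      iteratedFDeriv ℝ 3 f x ![EuclideanSpace.single i 1, EuclideanSpace.single j 1,
        EuclideanSpace.single k 1] := fun x hx => by
    have e : partialD j (partialD k f) =ᶠ[𝓝 x] _ := mem_of_superset (hΩ.mem_nhds hx) (h2 j k)
    rw [(e.partialD i).eq_of_nhds, partialD_iteratedFDeriv ((hfx x hx).of_le (by norm_num))]
    rfl
  obtain ⟨C1, hC1⟩ := exists_iteratedFDeriv_apply_le (k := 1) (m := 3) hf hΩ hb (by norm_num)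
    ![EuclideanSpace.single i 1]
  obtain ⟨C2, hC2⟩ := exists_iteratedFDeriv_apply_le (k := 2) (m := 3) hf hΩ hb (by norm_num)
    ![EuclideanSpace.single i 1, EuclideanSpace.single j 1]
  obtain ⟨C3, hC3⟩ := exists_iteratedFDeriv_apply_le (k := 3) (m := 3) hf hΩ hb (by norm_num)
    ![EuclideanSpace.single i 1, EuclideanSpace.single j 1, EuclideanSpace.single k 1]
  refine ⟨max C1 (max C2 C3), fun x hx => ⟨?_, ?_, ?_⟩⟩
  · rw [h1 i x hx]; exact (hC1 x hx).trans (le_max_left _ _)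
  · rw [h2 i j x hx]; exact (hC2 x hx).trans ((le_max_left _ _).trans (le_max_right _ _))
  · rw [h3 x hx]; exact (hC3 x hx).trans ((le_max_right _ _).trans (le_max_right _ _))

/-- Meant for quantities built from $\nabla D$: $D$ has no regularity up to the boundary beyond
being constant outside a compact set. -/
theorem ContinuousOn.exists_abs_le_of_zero_off_compact {S : Set (EuclideanSpace ℝ (Fin n))}
    (hf : ContinuousOn f Ω) (hS : IsCompact S) (hSΩ : S ⊆ Ω) (h0 : ∀ x ∈ Ω \ S, f x = 0) :
    ∃ C, ∀ x ∈ Ω, |f x| ≤ C := by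
  obtain ⟨C, hC⟩ := hS.exists_bound_of_continuousOn (hf.mono hSΩ)
  refine ⟨max C 0, fun x hx => ?_⟩
  by_cases hxS : x ∈ S
  · exact (hC x hxS).trans (le_max_left _ _)
  · simp [h0 x ⟨hx, hxS⟩]

theorem exists_sum_le {ι : Type*} [Fintype ι] {X : Type*} {s : Set X} {u : ι → X → ℝ}
    (h : ∀ i, ∃ C, ∀ x ∈ s, |u i x| ≤ C) :
    ∃ C, ∀ x ∈ s, |∑ i, u i x| ≤ C := by
  choose C hC using h
  exact ⟨∑ i, C i, fun x hx => (Finset.abs_sum_le_sum_abs _ _).trans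
    (Finset.sum_le_sum fun i _ => hC i x hx)⟩

theorem exists_mul_le {X : Type*} {s : Set X} {u v : X → ℝ} (hu : ∃ C, ∀ x ∈ s, |u x| ≤ C)
    (hv : ∃ C, ∀ x ∈ s, |v x| ≤ C) : ∃ C, ∀ x ∈ s, |u x * v x| ≤ C := by
  obtain ⟨A, hA⟩ := hu
  obtain ⟨B, hB⟩ := hv
  refine ⟨A * B, fun x hx => ?_⟩
  rw [abs_mul]
  exact mul_le_mul (hA x hx) (hB x hx) (abs_nonneg _) ((abs_nonneg _).trans (hA x hx))

end Bounds

/-! ### From convexity in the conformal metric to a Euclidean Carleman weight. -/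

section GeometricWeight

variable {n : ℕ} {Ω Γ₀ : Set (EuclideanSpace ℝ (Fin n))} {c₀ : ℝ}
  {D d : EuclideanSpace ℝ (Fin n) → ℝ}

/-- A weight that is strictly convex and without critical points for the conformal metric is a
Carleman weight for the Euclidean Laplacian. -/
theorem GeometricAssumptions.exists_isCarlemanWeightAt (hΩ : IsOpen Ω)
    (hb : Bornology.IsBounded Ω) (hD : IsAdmissibleCoefficient Ω c₀ D)
    (hd : GeometricAssumptions Ω Γ₀ (conformalMetric D) d) :
    ∃ (a : EuclideanSpace ℝ (Fin n) → ℝ) (b : EuclideanSpace ℝ (Fin n) → Fin n → ℝ) (c M : ℝ),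
      0 < c ∧ ∀ x ∈ Ω, IsCarlemanWeightAt d a b c M x := by
  have hc₀ := hD.c₀_pos
  obtain ⟨S, hSc, hSΩ, hS1⟩ := hD.compactSupport
  obtain ⟨c₁, hc₁, hcrit⟩ := hd.no_critical
  have hDpos : ∀ x ∈ Ω, 0 < D x := fun x hx => (one_div_pos.2 hc₀).trans_le (hD.lower x hx)
  have hDx : ∀ x ∈ Ω, ContDiffAt ℝ 2 D x := fun x hx => hD.contDiffOn.contDiffAt (hΩ.mem_nhds hx)
  have hdx : ∀ x ∈ Ω, ContDiffAt ℝ 3 d x := fun x hx =>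
    hd.contDiffOn.contDiffAt (mem_of_superset (hΩ.mem_nhds hx) subset_closure)
  have hdx2 : ∀ x ∈ Ω, ContDiffAt ℝ 2 d x := fun x hx => (hdx x hx).of_le (by norm_num)
  -- These are the coefficients read off from the conformal Hessian. They satisfy $b\cdot\nabla
  -- d=a$, so in the direction $\nabla d$ the corrections sum to $a|\nabla d|^2-2a|\nabla
  -- d|^2=-a|\nabla d|^2$, the sign required by `convex_grad`.
  set a : EuclideanSpace ℝ (Fin n) → ℝ := fun x => -(1 / 2) * (D x)⁻¹ * gradDot D d x with ha
  set b : EuclideanSpace ℝ (Fin n) → Fin n → ℝ :=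
    fun x i => -(1 / 2) * (D x)⁻¹ * partialD i D x with hbdef
  have hax : ∀ x ∈ Ω, ContDiffAt ℝ 1 a x := fun x hx =>
    (contDiffAt_const.mul (((hDx x hx).of_le (by norm_num)).inv (hDpos x hx).ne')).mul
      ((hDx x hx).gradDot (hdx2 x hx) (by norm_num))
  have hbx (i : Fin n) : ∀ x ∈ Ω, ContDiffAt ℝ 1 (fun y => b y i) x := fun x hx =>
    (contDiffAt_const.mul (((hDx x hx).of_le (by norm_num)).inv (hDpos x hx).ne')).mul
      ((hDx x hx).partialD (by norm_num) i)
  have hD0 (i : Fin n) : ∀ x ∈ Ω \ S, partialD i D =ᶠ[𝓝 x] 0 := fun x hx => by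
    have h1 : D =ᶠ[𝓝 x] fun _ => 1 :=
      mem_of_superset ((hΩ.sdiff hSc.isClosed).mem_nhds hx) hS1
    refine (h1.partialD i).trans (Eventually.of_forall fun y => ?_)
    simp [partialD]
  have ha0 : ∀ x ∈ Ω \ S, a =ᶠ[𝓝 x] 0 := fun x hx => by
    filter_upwards [eventually_all.2 fun i => hD0 i x hx] with y hy
    simp [ha, gradDot, hy]
  obtain ⟨Ma, hMa⟩ := ContinuousOn.exists_abs_le_of_zero_off_compact
    (fun x hx => (hax x hx).continuousAt.continuousWithinAt) hSc hSΩ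
    fun x hx => (ha0 x hx).eq_of_nhds
  have hbB (i : Fin n) := ContinuousOn.exists_abs_le_of_zero_off_compact
    (fun x hx => (hbx i x hx).continuousAt.continuousWithinAt) hSc hSΩ
    fun x hx => by simp [hbdef, (hD0 i x hx).eq_of_nhds]
  have haB (i : Fin n) := ContinuousOn.exists_abs_le_of_zero_off_compact
    (f := partialD i a) (fun x hx =>
      ((hax x hx).partialD (k := 0) (by norm_num) i).continuousAt.continuousWithinAt) hSc hSΩ
    fun x hx => ((ha0 x hx).partialD_zero i).eq_of_nhds
  have hdB := exists_partialD_bounds hd.contDiffOn hΩ hb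
  have hd1 (i : Fin n) : ∃ C, ∀ x ∈ Ω, |partialD i d x| ≤ C :=
    (hdB i i i).imp fun C h x hx => (h x hx).1
  have hL1 : ∃ C, ∀ x ∈ Ω, |coordLaplacian d x| ≤ C :=
    exists_sum_le fun i => (hdB i i i).imp fun C h x hx => (h x hx).2.1
  have hL2 (i : Fin n) : ∃ C, ∀ x ∈ Ω, |partialD i (coordLaplacian d) x| ≤ C := by
    obtain ⟨C, hC⟩ := exists_sum_le (s := Ω)
      (u := fun j x => partialD i (partialD j (partialD j d)) x) fun j =>
      (hdB i j j).imp fun C h x hx => (h x hx).2.2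
    refine ⟨C, fun x hx => ?_⟩
    have := partialD_sum (x := x) (s := Finset.univ) (u := fun j => partialD j (partialD j d))
      (fun j _ => (((hdx x hx).partialD (k := 2) (by norm_num) j).partialD (k := 1)
        (by norm_num) j).differentiableAt one_ne_zero) i
    change |partialD i (fun y => ∑ j, partialD j (partialD j d) y) x| ≤ C
    rw [this]
    exact hC x hx
  have hgrad {u : EuclideanSpace ℝ (Fin n) → ℝ} (h : ∀ i, ∃ C, ∀ x ∈ Ω, |partialD i u x| ≤ C) :
      ∃ C, ∀ x ∈ Ω, |gradDot u u x| ≤ C := exists_sum_le fun i => exists_mul_le (h i) (h i)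
  obtain ⟨C1, hC1⟩ := exists_mul_le ⟨Ma, hMa⟩ ⟨Ma, hMa⟩
  obtain ⟨C2, hC2⟩ := exists_mul_le hL1 hL1
  obtain ⟨C3, hC3⟩ := exists_sum_le fun i => exists_mul_le (hbB i) (hbB i)
  obtain ⟨C4, hC4⟩ := hgrad haB
  obtain ⟨C5, hC5⟩ := hgrad hL2
  obtain ⟨C6, hC6⟩ := hgrad hd1
  -- The summand 1 gives $M\le M^2$, so a single constant bounds every quantity by $M^2$.
  set M := 1 + |C1| + |C2| + |C3| + |C4| + |C5| + |C6| with hM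
  have p1 := abs_nonneg C1
  have p2 := abs_nonneg C2
  have p3 := abs_nonneg C3
  have p4 := abs_nonneg C4
  have p5 := abs_nonneg C5
  have p6 := abs_nonneg C6
  have hMM : M ≤ M ^ 2 := by nlinarith
  have hMC {t C : ℝ} (h : |t| ≤ C) (h' : |C| ≤ M) : t ≤ M ^ 2 :=
    (le_abs_self t).trans (h.trans ((le_abs_self C).trans (h'.trans hMM)))
  -- The first entry is $2|X|_g^2\ge(2/c_0)|X|^2$; the second uses in addition $|\nabla d|^2\ge
  -- c_1^2/c_0$, from $|\mathcal Dd|_g^2=D|\nabla d|^2$.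
  refine ⟨a, b, min (2 / c₀) (2 * c₁ ^ 2 / c₀ ^ 2), M, by positivity, fun x hx => ?_⟩
  have hDx0 := hDpos x hx
  have hconv (X : Fin n → ℝ) : 2 * (D x)⁻¹ * ∑ i, X i ^ 2 ≤
      ∑ i, ∑ j, partialD i (partialD j d) x * X i * X j + a x * ∑ i, X i ^ 2
        - 2 * (∑ i, b x i * X i) * ∑ i, partialD i d x * X i := by
    have h := hd.convex x hx X
    rw [gHess_conformalMetric ((hDx x hx).of_le (by norm_num)) hDx0.ne' (hdx2 x hx),
      gInner_conformalMetric] at h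
    have e1 : ∑ i, b x i * X i = -(1 / 2) * (D x)⁻¹ * ∑ i, partialD i D x * X i := by
      simp only [hbdef, Finset.mul_sum, mul_assoc]
    have e2 : ∑ i, X i * X i = ∑ i, X i ^ 2 := by simp [sq]
    rw [e1, ha]
    rw [e2] at h
    linarith
  have hinv : 1 / c₀ ≤ (D x)⁻¹ := by
    rw [← one_div]; exact one_div_le_one_div_of_le hDx0 (hD.upper x hx)
  refine ⟨hdx x hx, hax x hx, fun X => ?_, ?_, ?_, ?_, ?_, ?_, ?_, ?_⟩
  · refine le_trans (mul_le_mul_of_nonneg_right ?_ (Finset.sum_nonneg fun i _ => sq_nonneg _))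
      (hconv X)
    calc _ ≤ 2 / c₀ := min_le_left _ _
      _ = 2 * (1 / c₀) := by ring
      _ ≤ _ := by gcongr
  · have h := hconv fun i => partialD i d x
    have e1 : ∑ i, partialD i d x ^ 2 = gradDot d d x := by simp [gradDot, sq]
    have e2 : ∑ i, b x i * partialD i d x = a x := by
      simp only [hbdef, ha, gradDot, Finset.mul_sum, mul_assoc]
    have e3 : ∑ i, partialD i d x * partialD i d x = gradDot d d x := rfl
    rw [e1, e2, e3] at h
    change _ ≤ hessDot d d d x + _ - _ at h
    have hN : c₁ ^ 2 ≤ D x * gradDot d d x := by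
      have h1 := hcrit x hx
      rw [Real.le_sqrt hc₁.le (by
        rw [gInner_conformalMetric]
        exact mul_nonneg (inv_nonneg.2 hDx0.le) (Finset.sum_nonneg fun i _ => mul_self_nonneg _)),
        gInner_conformalMetric] at h1
      refine h1.trans_eq ?_
      simp only [gGrad_conformalMetric hDx0.ne', gradDot, Finset.mul_sum]
      exact Finset.sum_congr rfl fun i _ => by field_simp
    have hN2 : c₁ ^ 2 / c₀ ≤ gradDot d d x := by
      rw [div_le_iff₀ hc₀, mul_comm]
      exact hN.trans (mul_le_mul_of_nonneg_right (hD.upper x hx) gradDot_self_nonneg)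
    have : min (2 / c₀) (2 * c₁ ^ 2 / c₀ ^ 2) ≤ 2 * (D x)⁻¹ * gradDot d d x := by
      calc _ ≤ 2 * c₁ ^ 2 / c₀ ^ 2 := min_le_right _ _
        _ = 2 * (1 / c₀) * (c₁ ^ 2 / c₀) := by field_simp
        _ ≤ _ := by gcongr
    linarith
  · rw [sq]; exact hMC (hC1 x hx) (by linarith)
  · rw [sq]; exact hMC (hC2 x hx) (by linarith)
  · simp only [sq (b x _)]; exact hMC (hC3 x hx) (by linarith)
  · exact hMC (hC4 x hx) (by linarith)
  · exact hMC (hC5 x hx) (by linarith)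
  · exact hMC (hC6 x hx) (by linarith)

end GeometricWeight

/-! ### Mollification and weak derivatives. -/

section Mollification

theorem iteratedFDeriv_comp_const_sub {G : Type*} [NormedAddCommGroup G] [NormedSpace ℝ G]
    {χ : G → ℝ} (hχ : ContDiff ℝ ∞ χ) {k : ℕ} (v : Fin k → G)
    (z y : G) :
    iteratedFDeriv ℝ k (fun u => χ (z - u)) y v = (-1) ^ k * iteratedFDeriv ℝ k χ (z - y) v := by
  have h : ContDiff ℝ ∞ fun u => χ (z + u) := hχ.comp (contDiff_const.add contDiff_id)
  have e : (fun u => χ (z - u)) = (fun u => χ (z + u)) ∘ (-ContinuousLinearMap.id ℝ G) := by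
    ext u; simp [sub_eq_add_neg]
  rw [e, ContinuousLinearMap.iteratedFDeriv_comp_right _ h y (WithTop.coe_le_coe.2 le_top)]
  have := (iteratedFDeriv ℝ k χ (z - y)).map_smul_univ (fun _ => (-1 : ℝ)) v
  simp only [neg_one_smul, Finset.prod_const, Finset.card_univ, Fintype.card_fin] at this
  simpa [iteratedFDeriv_comp_add_left, sub_eq_add_neg] using this

variable {G : Type*} [NormedAddCommGroup G] [NormedSpace ℝ G] [FiniteDimensional ℝ G]
  [MeasureSpace G] [BorelSpace G] [(volume : Measure G).IsAddHaarMeasure]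

theorem iteratedFDeriv_convolution_right {f χ : G → ℝ} (hf : LocallyIntegrable f)
    (hχ : ContDiff ℝ ∞ χ) (hc : HasCompactSupport χ) {k : ℕ} (v : Fin k → G) (z : G) :
    iteratedFDeriv ℝ k (convolution f χ (ContinuousLinearMap.lsmul ℝ ℝ) volume) z v =
      convolution f (fun u => iteratedFDeriv ℝ k χ u v) (ContinuousLinearMap.lsmul ℝ ℝ) volume z := by
  induction k generalizing z with
  | zero => simp
  | succ k ih =>
    set F := convolution f χ (ContinuousLinearMap.lsmul ℝ ℝ) volume
    have hF : ContDiff ℝ ∞ F := hc.contDiff_convolution_right _ hf hχ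
    have diff (g : G → ℝ) (hg : ContDiff ℝ ∞ g) (y : G) :
        DifferentiableAt ℝ (iteratedFDeriv ℝ k g) y :=
      hg.differentiable_iteratedFDeriv (WithTop.coe_lt_coe.2 (ENat.natCast_lt_top k)) y
    set χk := fun u => iteratedFDeriv ℝ k χ u (Fin.tail v)
    have hχk : ContDiff ℝ 1 χk := by
      have h1 : ContDiff ℝ 1 (iteratedFDeriv ℝ k χ) :=
        hχ.iteratedFDeriv_right (m := 1) (WithTop.coe_le_coe.2 le_top)
      exact (ContinuousMultilinearMap.apply ℝ (fun _ : Fin k => G) ℝ (Fin.tail v)).contDiff.comp h1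
    have hck : HasCompactSupport χk :=
      (hc.iteratedFDeriv (𝕜 := ℝ) k).comp_left
        (g := fun L : G [×k]→L[ℝ] ℝ => L (Fin.tail v)) rfl
    have e1 : (fun y => iteratedFDeriv ℝ k F y (Fin.tail v)) =
        convolution f χk (ContinuousLinearMap.lsmul ℝ ℝ) volume :=
      funext fun y => ih (Fin.tail v) y
    have e2 (g : G → ℝ) (hg : ContDiff ℝ ∞ g) (y : G) : iteratedFDeriv ℝ (k + 1) g y v =
        fderiv ℝ (fun u => iteratedFDeriv ℝ k g u (Fin.tail v)) y (v 0) := by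
      rw [iteratedFDeriv_succ_apply_left,
        fderiv_continuousMultilinear_apply_const_apply (diff g hg y)]
    rw [e2 F hF z, e1, (hck.hasFDerivAt_convolution_right _ hf hχk z).fderiv,
      convolution_precompR_apply _ hf (hck.fderiv (𝕜 := ℝ)) (hχk.continuous_fderiv one_ne_zero)]
    congr 1
    exact funext fun u => (e2 χ hχ u).symm

/-- The mollification of `f`, extended by zero outside `U`. -/
noncomputable def mollify (U : Set G) (f : G → ℝ) (φ : ContDiffBump (0 : G)) : G → ℝ :=
  convolution (U.indicator f) (φ.normed volume) (ContinuousLinearMap.lsmul ℝ ℝ) volume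

variable {U : Set G} {f : G → ℝ} {φ : ContDiffBump (0 : G)}

theorem contDiff_mollify (hU : MeasurableSet U) (hf : IntegrableOn f U) :
    ContDiff ℝ ∞ (mollify U f φ) :=
  φ.hasCompactSupport_normed.contDiff_convolution_right _
    ((integrable_indicator_iff hU).2 hf).locallyIntegrable φ.contDiff_normed

/-- While the mollifier's ball around $z$ stays in $U$, the translated and reflected kernel is a
test function, so the derivative of the mollification is an average of the weak derivative against a
probability density. -/
theorem abs_iteratedFDeriv_mollify_le (hU : MeasurableSet U) (hf : IntegrableOn f U) {k : ℕ}
    {v : Fin k → G} {g : G → ℝ} (hg : HasWeakDeriv U v f g) {C : ℝ}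
    (hC : ∀ᵐ y ∂(volume.restrict U), |g y| ≤ C) {z : G} (hz : Metric.closedBall z φ.rOut ⊆ U) :
    |iteratedFDeriv ℝ k (mollify U f φ) z v| ≤ C := by
  set ψ := φ.normed volume
  have hψ : ContDiff ℝ ∞ ψ := φ.contDiff_normed
  have hsupp : tsupport (fun y => ψ (z - y)) ⊆ Metric.closedBall z φ.rOut := by
    refine closure_minimal (fun y hy => ?_) Metric.isClosed_closedBall
    have h1 : z - y ∈ Metric.closedBall (0 : G) φ.rOut := by
      rw [← φ.tsupport_normed_eq (μ := volume)]
      exact subset_tsupport _ hy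
    simpa [dist_eq_norm, norm_sub_rev] using h1
  have htest : IsTestFunction U fun y => ψ (z - y) :=
    ⟨hψ.comp (contDiff_const.sub contDiff_id),
      (isCompact_closedBall z φ.rOut).of_isClosed_subset (isClosed_tsupport _) hsupp,
      hsupp.trans hz⟩
  have hloc : LocallyIntegrable (U.indicator f) :=
    ((integrable_indicator_iff hU).2 hf).locallyIntegrable
  have e1 : iteratedFDeriv ℝ k (mollify U f φ) z v = ∫ y in U, g y * ψ (z - y) := by
    have h2 := hg.2.2 _ htest
    have h3 : ∫ y in U, f y * iteratedFDeriv ℝ k (fun y => ψ (z - y)) y v =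
        (-1) ^ k * ∫ y in U, f y * iteratedFDeriv ℝ k ψ (z - y) v := by
      rw [← integral_const_mul]
      refine integral_congr_ae (Eventually.of_forall fun y => ?_)
      simp only [iteratedFDeriv_comp_const_sub hψ]
      ring
    rw [h3] at h2
    have h4 := mul_left_cancel₀ (pow_ne_zero k (by norm_num)) h2
    rw [mollify, iteratedFDeriv_convolution_right hloc hψ φ.hasCompactSupport_normed, ← h4,
      ← integral_indicator hU]
    refine integral_congr_ae (Eventually.of_forall fun y => ?_)
    by_cases hy : y ∈ U <;> simp [hy]
  have hint : Integrable fun y => ψ (z - y) :=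
    htest.smooth.continuous.integrable_of_hasCompactSupport htest.compactSupport
  have hnn : ∀ y, 0 ≤ ψ (z - y) := fun y => φ.nonneg_normed _
  have hCnn : 0 ≤ C := by
    have h0 : volume U ≠ 0 := ((Metric.measure_ball_pos volume z φ.rOut_pos).trans_le
      (measure_mono (Metric.ball_subset_closedBall.trans hz))).ne'
    have : (ae (volume.restrict U)).NeBot := by
      rw [ae_neBot]; simpa using h0
    obtain ⟨y, hy⟩ := hC.exists
    exact (abs_nonneg _).trans hy
  rw [e1]
  calc |∫ y in U, g y * ψ (z - y)| ≤ ∫ y in U, C * ψ (z - y) := by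
        rw [← Real.norm_eq_abs]
        refine norm_integral_le_of_norm_le (hint.const_mul C).integrableOn ?_
        filter_upwards [hC] with y hy
        rw [Real.norm_eq_abs, abs_mul, abs_of_nonneg (hnn y)]
        exact mul_le_mul_of_nonneg_right hy (hnn y)
    _ ≤ ∫ y, C * ψ (z - y) := setIntegral_le_integral (hint.const_mul C)
        (Eventually.of_forall fun y => mul_nonneg hCnn (hnn y))
    _ = C := by
        rw [integral_const_mul, integral_sub_left_eq_self ψ volume z]
        simp [ψ, φ.integral_normed]

theorem tendsto_mollify (hU : IsOpen U) (hf : IntegrableOn f U) (hfc : ContinuousOn f U)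
    {φ : ℕ → ContDiffBump (0 : G)} (hφ : Tendsto (fun k => (φ k).rOut) atTop (𝓝 0)) {z : G}
    (hz : z ∈ U) : Tendsto (fun k => mollify U f (φ k) z) atTop (𝓝 (f z)) := by
  have h1 : Tendsto (U.indicator f) (𝓝 z) (𝓝 (f z)) := by
    refine (hfc.continuousAt (hU.mem_nhds hz)).tendsto.congr' ?_
    filter_upwards [hU.mem_nhds hz] with y hy
    simp [hy]
  have h2 := ContDiffBump.convolution_tendsto_right (μ := volume) (E' := ℝ)
    (g := fun _ => U.indicator f) (k := fun _ => z) hφ (Eventually.of_forall fun _ =>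
      ((integrable_indicator_iff hU.measurableSet).2 hf).aestronglyMeasurable)
    (h1.comp tendsto_snd) tendsto_const_nhds
  refine h2.congr fun k => ?_
  rw [convolution_eq_swap, mollify, convolution]
  simp [mul_comm]

end Mollification

/-! ### A form of $C^{1,1}$ regularity stable under pointwise limits. -/

section QuadraticApproximation

variable {E : Type*} [NormedAddCommGroup E] [NormedSpace ℝ E] {V : Set E} {M : ℝ} {f : E → ℝ}

/-- `f` is bounded by `M` on `V`, and has at each point of `V` an affine approximation with slope
at most `M` and with an error at most `M ‖y - x‖²`. -/
def HasQuadraticApprox (M : ℝ) (V : Set E) (f : E → ℝ) : Prop :=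
  ∀ x ∈ V, |f x| ≤ M ∧ ∃ A : E →L[ℝ] ℝ, ‖A‖ ≤ M ∧
    ∀ y ∈ V, |f y - f x - A (y - x)| ≤ M * ‖y - x‖ ^ 2

/-- The slopes lie in a compact ball of the dual, so along a subsequence they converge, and the
limit serves for all $y$ at once. -/
theorem HasQuadraticApprox.of_tendsto [FiniteDimensional ℝ E] {F : ℕ → E → ℝ}
    (hF : ∀ k, HasQuadraticApprox M V (F k))
    (h : ∀ x ∈ V, Tendsto (fun k => F k x) atTop (𝓝 (f x))) : HasQuadraticApprox M V f := by
  intro x hx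
  refine ⟨le_of_tendsto (h x hx).abs (Eventually.of_forall fun k => (hF k x hx).1), ?_⟩
  choose A hA hAy using fun k => (hF k x hx).2
  have : ProperSpace (E →L[ℝ] ℝ) := FiniteDimensional.proper ℝ _
  obtain ⟨B, hB, φ, hφ, hlim⟩ := (isCompact_closedBall (0 : E →L[ℝ] ℝ) M).tendsto_subseq
    (x := A) fun k => by simpa using hA k
  refine ⟨B, by simpa using hB, fun y hy => ?_⟩
  have h1 : Tendsto (fun k => A (φ k) (y - x)) atTop (𝓝 (B (y - x))) :=
    ((ContinuousLinearMap.apply ℝ ℝ (y - x)).continuous.tendsto B).comp hlim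
  have h2 := (((h y hy).comp hφ.tendsto_atTop).sub ((h x hx).comp hφ.tendsto_atTop)).sub h1
  exact le_of_tendsto h2.abs (Eventually.of_forall fun k => hAy (φ k) y hy)

theorem hasFDerivAt_of_quadratic_error {x : E} {A : E →L[ℝ] ℝ} (hV : V ∈ 𝓝 x)
    (h : ∀ y ∈ V, |f y - f x - A (y - x)| ≤ M * ‖y - x‖ ^ 2) : HasFDerivAt f A x := by
  rw [hasFDerivAt_iff_isLittleO]
  have h1 : (fun y => f y - f x - A (y - x)) =O[𝓝 x] fun y => ‖y - x‖ ^ 2 := by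
    refine Asymptotics.IsBigO.of_bound M ?_
    filter_upwards [hV] with y hy
    simpa using h y hy
  refine h1.trans_isLittleO ?_
  refine Asymptotics.isLittleO_iff.2 fun c hc => ?_
  filter_upwards [Metric.ball_mem_nhds x hc] with y hy
  rw [norm_pow, norm_norm, sq]
  exact mul_le_mul_of_nonneg_right (by simpa [dist_eq_norm] using (Metric.mem_ball.1 hy).le)
    (norm_nonneg _)

theorem HasQuadraticApprox.norm_fderiv_le (h : HasQuadraticApprox M V f) (hV : IsOpen V) {x : E}
    (hx : x ∈ V) : ‖fderiv ℝ f x‖ ≤ M ∧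
      ∀ y ∈ V, |f y - f x - fderiv ℝ f x (y - x)| ≤ M * ‖y - x‖ ^ 2 := by
  obtain ⟨A, hA, hAy⟩ := (h x hx).2
  rw [(hasFDerivAt_of_quadratic_error (hV.mem_nhds hx) hAy).fderiv]
  exact ⟨hA, hAy⟩

/-- Comparing the affine approximations at $x$ and $y$ at a third point $z$ shows that the
derivative is Lipschitz at $x$. This bounds `fderiv` of the derivative even at points where the
second derivative fails to exist and the value is zero by convention. -/
theorem HasQuadraticApprox.norm_fderiv_fderiv_le (h : HasQuadraticApprox M V f) (hV : IsOpen V)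
    {x : E} (hx : x ∈ V) : ‖fderiv ℝ (fderiv ℝ f) x‖ ≤ 6 * M := by
  have hM : 0 ≤ M := (abs_nonneg _).trans (h x hx).1
  refine norm_fderiv_le_of_lip' ℝ (by positivity) ?_
  obtain ⟨r, hr, hball⟩ := Metric.isOpen_iff.1 hV x hx
  filter_upwards [Metric.ball_mem_nhds x (half_pos hr)] with y hy
  have hyV : y ∈ V := hball (Metric.ball_subset_ball (by linarith) hy)
  rcases eq_or_ne y x with rfl | hyx
  · simp
  have hδ : 0 < ‖y - x‖ := norm_pos_iff.2 (sub_ne_zero.2 hyx)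
  have hyr : ‖y - x‖ < r / 2 := by simpa [dist_eq_norm] using hy
  refine ContinuousLinearMap.opNorm_le_of_unit_norm (by positivity) fun u hu => ?_
  set δ := ‖y - x‖
  -- With $|z-y|=\delta$ and $|z-x|\le2\delta$, the three quadratic errors are $4M\delta^2$,
  -- $M\delta^2$ and $M\delta^2$, whence the factor 6.
  set z := y + δ • u with hz
  have hzy : z - y = δ • u := by simp [hz]
  have hzyn : ‖z - y‖ = δ := by rw [hzy, norm_smul, hu, mul_one, Real.norm_of_nonneg hδ.le]
  have hzx : ‖z - x‖ ≤ 2 * δ := by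
    calc ‖z - x‖ = ‖(z - y) + (y - x)‖ := by rw [sub_add_sub_cancel]
      _ ≤ ‖z - y‖ + ‖y - x‖ := norm_add_le _ _
      _ = 2 * δ := by rw [hzyn]; ring
  have hzV : z ∈ V := hball (by rw [Metric.mem_ball, dist_eq_norm]; linarith)
  have h1 := abs_le.1 ((h.norm_fderiv_le hV hx).2 z hzV)
  have h2 := abs_le.1 ((h.norm_fderiv_le hV hyV).2 z hzV)
  have h3 := abs_le.1 ((h.norm_fderiv_le hV hx).2 y hyV)
  have h4 : M * ‖z - x‖ ^ 2 ≤ M * (2 * δ) ^ 2 := by gcongr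
  have h5 : fderiv ℝ f x (z - x) = fderiv ℝ f x (z - y) + fderiv ℝ f x (y - x) := by
    rw [← map_add, sub_add_sub_cancel]
  have h6 : δ * |fderiv ℝ f y u - fderiv ℝ f x u| ≤ δ * (6 * M * δ) := by
    have : δ * |fderiv ℝ f y u - fderiv ℝ f x u| = |fderiv ℝ f y (z - y) - fderiv ℝ f x (z - y)| := by
      rw [hzy, map_smul, map_smul, smul_eq_mul, smul_eq_mul, ← mul_sub, abs_mul, abs_of_pos hδ]
    rw [this, abs_le]
    rw [hzyn] at h2
    constructor <;> nlinarith
  simpa using le_of_mul_le_mul_left h6 hδ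

/-- The mean value inequality used twice on the segment, first for the derivative and then for $f$
minus its linear part. -/
theorem HasQuadraticApprox.of_contDiff (hf : ContDiff ℝ 2 f) (hV : Convex ℝ V)
    (h0 : ∀ x ∈ V, |f x| ≤ M) (h1 : ∀ x ∈ V, ‖fderiv ℝ f x‖ ≤ M)
    (h2 : ∀ x ∈ V, ‖fderiv ℝ (fderiv ℝ f) x‖ ≤ M) : HasQuadraticApprox M V f := by
  intro x hx
  refine ⟨h0 x hx, fderiv ℝ f x, h1 x hx, fun y hy => ?_⟩
  have hM : 0 ≤ M := (abs_nonneg _).trans (h0 x hx)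
  have hseg : segment ℝ x y ⊆ V := hV.segment_subset hx hy
  have hd : Differentiable ℝ (fderiv ℝ f) :=
    (hf.fderiv_right (m := 1) (by norm_num)).differentiable one_ne_zero
  have key := Convex.norm_image_sub_le_of_norm_fderiv_le' (𝕜 := ℝ) (s := segment ℝ x y) (x := x)
    (y := y) (φ := fderiv ℝ f x) (C := M * ‖y - x‖)
    (fun z _ => hf.differentiable two_ne_zero z) (fun z hz => ?_) (convex_segment x y)
    (left_mem_segment ℝ x y) (right_mem_segment ℝ x y)
  · rw [sq, ← mul_assoc]
    exact key
  · refine (Convex.norm_image_sub_le_of_norm_fderiv_le (𝕜 := ℝ) (fun u _ => hd u)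
      (fun u hu => h2 u (hseg hu)) (convex_segment x y) (left_mem_segment ℝ x y) hz).trans ?_
    exact mul_le_mul_of_nonneg_left (norm_sub_le_of_mem_segment hz) hM

theorem norm_le_sum_norm_apply_single {n : ℕ} {F : Type*} [NormedAddCommGroup F] [NormedSpace ℝ F]
    (A : EuclideanSpace ℝ (Fin n) →L[ℝ] F) :
    ‖A‖ ≤ ∑ i, ‖A (EuclideanSpace.single i 1)‖ := by
  refine A.opNorm_le_bound (Finset.sum_nonneg fun _ _ => norm_nonneg _) fun x => ?_
  have hx : x = ∑ i, x i • EuclideanSpace.single i (1 : ℝ) := by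
    simpa using ((EuclideanSpace.basisFun (Fin n) ℝ).sum_repr x).symm
  conv_lhs => rw [hx]
  rw [map_sum, Finset.sum_mul]
  refine (norm_sum_le _ _).trans (Finset.sum_le_sum fun i _ => ?_)
  rw [map_smul, norm_smul, mul_comm]
  exact mul_le_mul_of_nonneg_left (PiLp.norm_apply_le x i) (norm_nonneg _)

end QuadraticApproximation

/-! ### Uniqueness of weak derivatives. -/

section WeakDerivatives

theorem hasWeakDeriv_zero {E : Type*} [NormedAddCommGroup E] [NormedSpace ℝ E] [MeasureSpace E]
    {U : Set E} {f : E → ℝ} (hf : LocallyIntegrableOn f U) (v : Fin 0 → E) :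
    HasWeakDeriv U v f f :=
  ⟨hf, hf, fun φ _ => by simp⟩

theorem MeasureTheory.LocallyIntegrableOn.integrableOn_mul_of_tsupport_subset {E : Type*}
    [NormedAddCommGroup E] [MeasureSpace E] [BorelSpace E] {U : Set E} {f φ : E → ℝ}
    (hf : LocallyIntegrableOn f U) (hφ : Continuous φ) (hc : HasCompactSupport φ)
    (hU : tsupport φ ⊆ U) : IntegrableOn (fun x => f x * φ x) U := by
  have h4 : IntegrableOn (fun x => f x * φ x) (tsupport φ) :=
    (hf.integrableOn_compact_subset hU hc).mul_continuousOn_of_subset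
      hφ.continuousOn (isClosed_tsupport φ).measurableSet hc Subset.rfl
  have h5 : Integrable (fun x => f x * φ x) :=
    (integrableOn_iff_integrable_of_support_subset (f := fun x => f x * φ x) fun x hx =>
      subset_tsupport _ (right_ne_zero_of_mul (Function.mem_support.1 hx))).1 h4
  exact h5.integrableOn

variable {E : Type*} [NormedAddCommGroup E] [NormedSpace ℝ E] [FiniteDimensional ℝ E]
  [MeasureSpace E] [BorelSpace E] {U : Set E} {f g g' : E → ℝ}

theorem ae_eq_of_integral_mul_testFunction_eq (hU : IsOpen U) (hg : LocallyIntegrableOn g U)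
    (hg' : LocallyIntegrableOn g' U)
    (h : ∀ φ, IsTestFunction U φ → ∫ x in U, g x * φ x = ∫ x in U, g' x * φ x) :
    ∀ᵐ x ∂(volume.restrict U), g x = g' x := by
  have key := hU.ae_eq_zero_of_integral_contDiff_smul_eq_zero (hg.sub hg') fun φ h1 h2 h3 => ?_
  · rw [ae_restrict_iff' hU.measurableSet]
    filter_upwards [key] with x hx hxU
    exact sub_eq_zero.1 (hx hxU)
  · have hint (u : E → ℝ) (hu : LocallyIntegrableOn u U) : IntegrableOn (fun x => u x * φ x) U :=
      hu.integrableOn_mul_of_tsupport_subset h1.continuous h2 h3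
    have h6 : ∀ x ∉ U, φ x • (g - g') x = 0 := fun x hx => by
      rw [image_eq_zero_of_notMem_tsupport fun hx' => hx (h3 hx'), zero_smul]
    rw [← setIntegral_eq_integral_of_forall_compl_eq_zero h6]
    have h7 : ∀ x, φ x • (g - g') x = g x * φ x - g' x * φ x := fun x => by
      simp only [Pi.sub_apply, smul_eq_mul]; ring
    simp only [h7]
    rw [integral_sub (hint g hg) (hint g' hg'), h φ ⟨h1, h2, h3⟩, sub_self]

theorem HasWeakDeriv.ae_eq {k : ℕ} {v : Fin k → E} (hU : IsOpen U) (h : HasWeakDeriv U v f g)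
    (h' : HasWeakDeriv U v f g') : ∀ᵐ x ∂(volume.restrict U), g x = g' x :=
  ae_eq_of_integral_mul_testFunction_eq hU h.2.1 h'.2.1 fun φ hφ =>
    mul_left_cancel₀ (pow_ne_zero k (by norm_num)) ((h.2.2 φ hφ).symm.trans (h'.2.2 φ hφ))

end WeakDerivatives

/-! ### Bounds for the trace of $R$ at time zero. -/

section Trace

theorem MemSobolev.exists_ae_bound {E : Type*} [NormedAddCommGroup E] [NormedSpace ℝ E]
    [MeasureSpace E] {U : Set E} {f : E → ℝ} {m k : ℕ} (h : MemSobolev m ⊤ U f) (hk : k ≤ m)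
    (v : Fin k → E) : ∃ (C : ℝ) (g : E → ℝ), HasWeakDeriv U v f g ∧
      ∀ᵐ x ∂(volume.restrict U), |g x| ≤ C := by
  obtain ⟨g, hg, hw⟩ := h k hk v
  refine ⟨(eLpNormEssSup g (volume.restrict U)).toReal, g, hw, ?_⟩
  have hfin : eLpNormEssSup g (volume.restrict U) ≠ ⊤ := by
    simpa [eLpNorm_exponent_top] using hg.2.ne
  filter_upwards [ae_le_eLpNormEssSup (f := g) (μ := volume.restrict U)] with x hx
  have := ENNReal.toReal_mono hfin hx
  simpa using this

theorem MemSobolev.memLp {E : Type*} [NormedAddCommGroup E] [NormedSpace ℝ E]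
    [FiniteDimensional ℝ E] [MeasureSpace E] [BorelSpace E] {U : Set E} {f : E → ℝ} {m : ℕ}
    {p : ℝ≥0∞} (h : MemSobolev m p U f) (hU : IsOpen U) : MemLp f p (volume.restrict U) := by
  obtain ⟨g, hg, hw⟩ := h 0 (Nat.zero_le _) Fin.elim0
  exact (memLp_congr_ae ((hasWeakDeriv_zero hw.1 _).ae_eq hU hw)).2 hg

variable {n : ℕ} {Ω : Set (EuclideanSpace ℝ (Fin n))} {T : ℝ}
  {R : EuclideanSpace ℝ (Fin n) × ℝ → ℝ}

instance : (volume : Measure (EuclideanSpace ℝ (Fin n) × ℝ)).IsAddHaarMeasure :=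
  Measure.prod.instIsAddHaarMeasure volume volume

theorem iteratedFDeriv_slice {H : EuclideanSpace ℝ (Fin n) × ℝ → ℝ} (hH : ContDiff ℝ ∞ H) (t : ℝ)
    {k : ℕ} (x : EuclideanSpace ℝ (Fin n)) (v : Fin k → EuclideanSpace ℝ (Fin n)) :
    iteratedFDeriv ℝ k (fun y => H (y, t)) x v =
      iteratedFDeriv ℝ k H (x, t) fun i => (v i, (0 : ℝ)) := by
  have h : ContDiff ℝ ∞ fun p => H (p + (0, t)) := hH.comp (contDiff_id.add contDiff_const)
  have e : (fun y => H (y, t)) =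
      (fun p => H (p + (0, t))) ∘ ContinuousLinearMap.inl ℝ (EuclideanSpace ℝ (Fin n)) ℝ := by
    ext y; simp
  rw [e, ContinuousLinearMap.iteratedFDeriv_comp_right _ h x (WithTop.coe_le_coe.2 le_top),
    iteratedFDeriv_comp_add_right]
  simp

theorem norm_fderiv_le_sum (f : EuclideanSpace ℝ (Fin n) → ℝ) (x : EuclideanSpace ℝ (Fin n)) :
    ‖fderiv ℝ f x‖ ≤ ∑ i, |iteratedFDeriv ℝ 1 f x ![EuclideanSpace.single i 1]| := by
  simpa [iteratedFDeriv_one_apply] using norm_le_sum_norm_apply_single (fderiv ℝ f x)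

theorem norm_fderiv_fderiv_le_sum (f : EuclideanSpace ℝ (Fin n) → ℝ)
    (x : EuclideanSpace ℝ (Fin n)) :
    ‖fderiv ℝ (fderiv ℝ f) x‖ ≤ ∑ i, ∑ j, |iteratedFDeriv ℝ 2 f x
      ![EuclideanSpace.single i 1, EuclideanSpace.single j 1]| := by
  refine (norm_le_sum_norm_apply_single _).trans (Finset.sum_le_sum fun i _ => ?_)
  simpa [iteratedFDeriv_two_apply] using
    norm_le_sum_norm_apply_single (fderiv ℝ (fderiv ℝ f) x (EuclideanSpace.single i 1))

/-- The mollifications of a function in `W^{2,∞}` have uniform quadratic approximations along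
slices. -/
theorem MemSobolev.exists_hasQuadraticApprox_mollify {U : Set (EuclideanSpace ℝ (Fin n) × ℝ)}
    (hU : MeasurableSet U) (hR : MemSobolev 3 ⊤ U R) (hRI : IntegrableOn R U) :
    ∃ M : ℝ, ∀ (t : ℝ) (φ : ContDiffBump (0 : EuclideanSpace ℝ (Fin n) × ℝ))
      (V : Set (EuclideanSpace ℝ (Fin n))), Convex ℝ V →
      (∀ x ∈ V, Metric.closedBall (x, t) φ.rOut ⊆ U) →
      HasQuadraticApprox M V fun x => mollify U R φ (x, t) := by
  obtain ⟨C0, g0, hg0, hC0⟩ := hR.exists_ae_bound (Nat.zero_le _) Fin.elim0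
  choose C1 g1 hg1 hC1 using fun i : Fin n => hR.exists_ae_bound (k := 1) (by norm_num)
    fun j : Fin 1 => (![EuclideanSpace.single i (1 : ℝ)] j, (0 : ℝ))
  choose C2 g2 hg2 hC2 using fun i j : Fin n => hR.exists_ae_bound (k := 2) (by norm_num)
    fun l : Fin 2 => (![EuclideanSpace.single i (1 : ℝ), EuclideanSpace.single j (1 : ℝ)] l, (0 : ℝ))
  refine ⟨max C0 (max (∑ i, C1 i) (∑ i, ∑ j, C2 i j)), fun t φ V hV hVU => ?_⟩
  have hH : ContDiff ℝ ∞ (mollify U R φ) := contDiff_mollify hU hRI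
  have hh : ContDiff ℝ 2 fun x => mollify U R φ (x, t) :=
    (hH.of_le (WithTop.coe_le_coe.2 le_top)).comp (contDiff_id.prodMk contDiff_const)
  refine HasQuadraticApprox.of_contDiff hh hV (fun x hx => ?_) (fun x hx => ?_) fun x hx => ?_
  · refine le_trans ?_ (le_max_left _ _)
    simpa using abs_iteratedFDeriv_mollify_le hU hRI hg0 hC0 (hVU x hx)
  · refine le_trans ?_ ((le_max_left _ _).trans (le_max_right _ _))
    refine (norm_fderiv_le_sum _ _).trans (Finset.sum_le_sum fun i _ => ?_)
    rw [iteratedFDeriv_slice hH]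
    exact abs_iteratedFDeriv_mollify_le hU hRI (hg1 i) (hC1 i) (hVU x hx)
  · refine le_trans ?_ ((le_max_right _ _).trans (le_max_right _ _))
    refine (norm_fderiv_fderiv_le_sum _ _).trans
      (Finset.sum_le_sum fun i _ => Finset.sum_le_sum fun j _ => ?_)
    rw [iteratedFDeriv_slice hH]
    exact abs_iteratedFDeriv_mollify_le hU hRI (hg2 i j) (hC2 i j) (hVU x hx)

/-- The trace at time zero of a function in `W^{3,∞}(Ω × (0,T))` is locally of class `C^{1,1}`,
with uniform bounds. -/
theorem exists_hasQuadraticApprox_trace (hΩ : IsOpen Ω) (hb : Bornology.IsBounded Ω) (hT : 0 < T)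
    (hR : MemSobolev 3 ⊤ (Ω ×ˢ Ioo 0 T) R) (hRc : ContinuousOn R (Ω ×ˢ Ico 0 T)) :
    ∃ M : ℝ, ∀ x ∈ Ω, ∃ r > 0, Metric.ball x r ⊆ Ω ∧
      HasQuadraticApprox M (Metric.ball x r) fun y => R (y, 0) := by
  have hUo : IsOpen (Ω ×ˢ Ioo 0 T) := hΩ.prod isOpen_Ioo
  have hUb : Bornology.IsBounded (Ω ×ˢ Ioo 0 T) := hb.prod (Metric.isBounded_Ioo 0 T)
  have : IsFiniteMeasure (volume.restrict (Ω ×ˢ Ioo 0 T)) :=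
    ⟨by simpa using hUb.measure_lt_top⟩
  have hRI : IntegrableOn R (Ω ×ˢ Ioo 0 T) := (hR.memLp hUo).integrable le_top
  obtain ⟨M, hM⟩ := hR.exists_hasQuadraticApprox_mollify hUo.measurableSet hRI
  refine ⟨M, fun x hx => ?_⟩
  obtain ⟨ρ, hρ, hball⟩ := Metric.isOpen_iff.1 hΩ x hx
  have hsub : Metric.ball x (ρ / 2) ⊆ Ω := (Metric.ball_subset_ball (by linarith)).trans hball
  refine ⟨ρ / 2, by positivity, hsub, ?_⟩
  have hslice : ∀ t ∈ Ioo 0 T, HasQuadraticApprox M (Metric.ball x (ρ / 2)) fun y => R (y, t) := by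
    intro t ht
    -- Mollification radii at most $\delta/2$ keep every ball centred over the half ball inside the
    -- open cylinder $\Omega\times(0,T)$.
    set δ := min (ρ / 2) (min t (T - t)) with hδ
    have hδ0 : 0 < δ := lt_min (by positivity) (lt_min ht.1 (by linarith [ht.2]))
    set φ : ℕ → ContDiffBump (0 : EuclideanSpace ℝ (Fin n) × ℝ) := fun k =>
      ⟨δ / 4 / (k + 1), δ / 2 / (k + 1), by positivity, by gcongr; norm_num⟩ with hφ
    have hφle (k : ℕ) : (φ k).rOut ≤ δ / 2 := div_le_self (by positivity) (by simp)
    have hφ0 : Tendsto (fun k => (φ k).rOut) atTop (𝓝 0) :=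
      tendsto_const_div_atTop_nhds_zero_nat (δ / 2) |>.comp (tendsto_add_atTop_nat 1) |>.congr
        fun k => by simp [hφ]
    refine HasQuadraticApprox.of_tendsto (fun k => hM t (φ k) _ (convex_ball _ _) fun y hy => ?_)
      fun y hy => tendsto_mollify hUo hRI (hRc.mono (prod_mono_right Ioo_subset_Ico_self)) hφ0
        ⟨hsub hy, ht⟩
    have h1 : δ ≤ ρ / 2 := min_le_left _ _
    have h2 : δ ≤ t := (min_le_right _ _).trans (min_le_left _ _)
    have h3 : δ ≤ T - t := (min_le_right _ _).trans (min_le_right _ _)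
    rintro ⟨z, s⟩ hz
    have hz' := (Metric.mem_closedBall.1 hz).trans (hφle k)
    rw [Prod.dist_eq] at hz'
    have hzy := (le_max_left _ _).trans hz'
    have hst := (le_max_right _ _).trans hz'
    simp only [Real.dist_eq] at hst hzy
    rw [abs_le] at hst
    refine ⟨hball ?_, ?_, ?_⟩
    · have := dist_triangle z y x
      have := Metric.mem_ball.1 hy
      rw [Metric.mem_ball]; linarith
    · simp only; linarith
    · simp only; linarith
  -- Second limit: the times $T/(2(k+1))$ decrease to 0 inside $(0,T)$, and $R$ is continuous up to
  -- $t=0$.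
  refine HasQuadraticApprox.of_tendsto (F := fun k : ℕ => fun y => R (y, T / 2 / (k + 1)))
    (fun k => hslice _ ⟨by positivity, ?_⟩) fun y hy => ?_
  · exact (div_le_self (by positivity) (by simp)).trans_lt (by linarith)
  · have ht : Tendsto (fun k : ℕ => T / 2 / ((k : ℝ) + 1)) atTop (𝓝 0) :=
      tendsto_const_div_atTop_nhds_zero_nat (T / 2) |>.comp (tendsto_add_atTop_nat 1) |>.congr
        fun k => by simp
    refine (hRc (y, 0) ⟨hsub hy, left_mem_Ico.2 hT⟩).tendsto.comp ?_
    refine tendsto_nhdsWithin_iff.2 ⟨tendsto_const_nhds.prodMk_nhds ht,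
      Eventually.of_forall fun k => ⟨hsub hy, by positivity, ?_⟩⟩
    exact (div_le_self (by positivity) (by simp)).trans_lt (by linarith)

/-- The bounds hold at every point of $\Omega$, with the pointwise values of `gradient` and
`Laplacian.laplacian`, which are the ones occurring in the equation for $w_{tt}(\cdot,0)$. -/
theorem exists_trace_bounds (hΩ : IsOpen Ω) (hb : Bornology.IsBounded Ω) (hT : 0 < T)
    (hR : MemSobolev 3 ⊤ (Ω ×ˢ Ioo 0 T) R) (hRc : ContinuousOn R (Ω ×ˢ Ico 0 T)) :
    ∃ M : ℝ, ∀ x ∈ Ω, |R (x, 0)| ≤ M ∧ ‖gradient (fun y => R (y, 0)) x‖ ≤ M ∧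
      |Laplacian.laplacian (fun y => R (y, 0)) x| ≤ M := by
  obtain ⟨M, hM⟩ := exists_hasQuadraticApprox_trace hΩ hb hT hR hRc
  refine ⟨max M (n * (6 * M)), fun x hx => ?_⟩
  obtain ⟨r, hr, -, hQ⟩ := hM x hx
  have hxr := Metric.mem_ball_self (x := x) hr
  refine ⟨(hQ x hxr).1.trans (le_max_left _ _), ?_, ?_⟩
  · refine le_trans ?_ (le_max_left _ _)
    rw [gradient, LinearIsometryEquiv.norm_map]
    exact (hQ.norm_fderiv_le Metric.isOpen_ball hxr).1
  · refine le_trans ?_ (le_max_right _ _)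
    rw [InnerProductSpace.laplacian_eq_iteratedFDeriv_orthonormalBasis _
      (EuclideanSpace.basisFun (Fin n) ℝ)]
    refine (Finset.abs_sum_le_sum_abs _ _).trans ?_
    have h2 := hQ.norm_fderiv_fderiv_le Metric.isOpen_ball hxr
    have h3 (i : Fin n) : |iteratedFDeriv ℝ 2 (fun y => R (y, 0)) x
        ![EuclideanSpace.basisFun (Fin n) ℝ i, EuclideanSpace.basisFun (Fin n) ℝ i]| ≤ 6 * M := by
      rw [iteratedFDeriv_two_apply]
      refine ((fderiv ℝ (fderiv ℝ fun y => R (y, 0)) x).le_opNorm₂ _ _).trans ?_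
      simpa using h2
    refine (Finset.sum_le_sum fun i _ => h3 i).trans ?_
    simp

end Trace

/-! ### Locality of weakly defined operators. -/

section Locality

variable {E : Type*} [NormedAddCommGroup E] [NormedSpace ℝ E] [FiniteDimensional ℝ E]
  [MeasureSpace E] [BorelSpace E] {U S : Set E} {f g : E → ℝ}

/-- The image of `f` under a weakly defined local operator vanishes where `f` does. -/
theorem ae_eq_zero_of_weak_local (hU : IsOpen U) (hS : IsClosed S)
    (hf : ∀ᵐ x ∂(volume.restrict U), x ∉ S → f x = 0) (hg : LocallyIntegrableOn g U)
    (B : (E → ℝ) → E → ℝ) (hB : ∀ φ, ∀ x ∉ tsupport φ, B φ x = 0)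
    (h : ∀ φ, IsTestFunction U φ → ∫ x in U, f x * B φ x = ∫ x in U, g x * φ x) :
    ∀ᵐ x ∂(volume.restrict U), x ∉ S → g x = 0 := by
  have hUS : IsOpen (U \ S) := hU.sdiff hS
  have key := ae_eq_of_integral_mul_testFunction_eq hUS (hg.mono_set sdiff_subset)
    (g' := fun _ => 0) (locallyIntegrable_zero.locallyIntegrableOn _) fun φ hφ => ?_
  · rw [ae_restrict_iff' hUS.measurableSet] at key
    rw [ae_restrict_iff' hU.measurableSet]
    filter_upwards [key] with x hx hxU hxS
    exact hx ⟨hxU, hxS⟩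
  · have h1 := h φ ⟨hφ.smooth, hφ.compactSupport, hφ.support_subset.trans sdiff_subset⟩
    have h2 : ∫ x in U, f x * B φ x = 0 := by
      refine integral_eq_zero_of_ae ?_
      filter_upwards [hf] with x hx
      by_cases hxS : x ∈ S
      · simp [hB φ x fun hx' => (hφ.support_subset hx').2 hxS]
      · simp [hx hxS]
    have h3 : ∀ x ∉ U \ S, g x * φ x = 0 := fun x hx => by
      rw [image_eq_zero_of_notMem_tsupport fun hx' => hx (hφ.support_subset hx'), mul_zero]
    have h4 : ∀ x ∉ U, g x * φ x = 0 := fun x hx => h3 x fun hx' => hx hx'.1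
    rw [setIntegral_eq_integral_of_forall_compl_eq_zero h3,
      ← setIntegral_eq_integral_of_forall_compl_eq_zero h4, ← h1, h2]
    simp

end Locality

/-! ### The weak Laplacian and second weak derivatives. -/

section Laplacian

variable {n : ℕ} {Ω : Set (EuclideanSpace ℝ (Fin n))} {F L : EuclideanSpace ℝ (Fin n) → ℝ}

theorem laplacian_eq_zero_of_notMem_tsupport {φ : EuclideanSpace ℝ (Fin n) → ℝ}
    {x : EuclideanSpace ℝ (Fin n)} (hx : x ∉ tsupport φ) : Laplacian.laplacian φ x = 0 := by
  rw [InnerProductSpace.laplacian_eq_iteratedFDeriv_orthonormalBasis _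
    (EuclideanSpace.basisFun (Fin n) ℝ)]
  refine Finset.sum_eq_zero fun i _ => ?_
  have : iteratedFDeriv ℝ 2 φ x = 0 := by
    by_contra h
    exact hx (support_iteratedFDeriv_subset 2 h)
  simp [this]

theorem IsTestFunction.integrableOn_mul_iteratedFDeriv {φ : EuclideanSpace ℝ (Fin n) → ℝ}
    (hφ : IsTestFunction Ω φ) (hF : LocallyIntegrableOn F Ω) {k : ℕ}
    (v : Fin k → EuclideanSpace ℝ (Fin n)) :
    IntegrableOn (fun x => F x * iteratedFDeriv ℝ k φ x v) Ω := by
  have hsub : tsupport (fun x => iteratedFDeriv ℝ k φ x v) ⊆ tsupport φ :=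
    closure_minimal (fun x hx => support_iteratedFDeriv_subset (𝕜 := ℝ) k
      (fun h => hx (by simp [h]))) (isClosed_tsupport _)
  refine hF.integrableOn_mul_of_tsupport_subset ?_
    (hφ.compactSupport.of_isClosed_subset (isClosed_tsupport _) hsub)
    (hsub.trans hφ.support_subset)
  exact (ContinuousMultilinearMap.apply ℝ
    (fun _ : Fin k => EuclideanSpace ℝ (Fin n)) ℝ v).continuous.comp
    (hφ.smooth.continuous_iteratedFDeriv (WithTop.coe_le_coe.2 le_top))

/-- The weak Laplacian is the sum of the pure second weak derivatives. -/
theorem HasWeakLaplacian.ae_eq_sum (hΩ : IsOpen Ω) (hL : HasWeakLaplacian Ω F L)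
    {g : Fin n → EuclideanSpace ℝ (Fin n) → ℝ}
    (hg : ∀ i, HasWeakDeriv Ω ![EuclideanSpace.single i 1, EuclideanSpace.single i 1] F (g i)) :
    ∀ᵐ x ∂(volume.restrict Ω), L x = ∑ i, g i x := by
  refine ae_eq_of_integral_mul_testFunction_eq hΩ hL.2.1 ?_ fun φ hφ => ?_
  · rw [locallyIntegrableOn_iff hΩ.isLocallyClosed]
    intro k hk hkc
    exact integrable_finsetSum _ fun i _ => (hg i).2.1.integrableOn_compact_subset hk hkc
  · rw [← hL.2.2 φ hφ, InnerProductSpace.laplacian_eq_iteratedFDeriv_orthonormalBasis φ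
      (EuclideanSpace.basisFun (Fin n) ℝ)]
    simp only [EuclideanSpace.basisFun_apply, Finset.mul_sum, Finset.sum_mul]
    rw [integral_finsetSum _ fun i _ => hφ.integrableOn_mul_iteratedFDeriv hL.1 _,
      integral_finsetSum _ fun i _ => (hg i).2.1.integrableOn_mul_of_tsupport_subset
        hφ.smooth.continuous hφ.compactSupport hφ.support_subset]
    refine Finset.sum_congr rfl fun i _ => ?_
    rw [(hg i).2.2 φ hφ]
    simp

end Laplacian

/-! ### Approximation in weighted $L^2$. -/

section Approximation

variable {X : Type*} [MeasurableSpace X] {μ : Measure X} {h u v : X → ℝ} {H : ℝ}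

theorem integrable_weight_mul_sq (hh : AEStronglyMeasurable h μ) (hH : ∀ᵐ x ∂μ, |h x| ≤ H)
    (hu : MemLp u 2 μ) : Integrable (fun x => h x * u x ^ 2) μ :=
  hu.integrable_sq.bdd_mul hh hH

/-- Pointwise $2v^2+2(v-u)^2-u^2=(2v-u)^2\ge0$. The factor 2 makes convergence of the weighted
integrals unnecessary when passing to the limit. -/
theorem integral_weight_mul_sq_le (hh : AEStronglyMeasurable h μ) (h0 : ∀ᵐ x ∂μ, 0 ≤ h x)
    (hH : ∀ᵐ x ∂μ, |h x| ≤ H) (hu : MemLp u 2 μ) (hv : MemLp v 2 μ) :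
    ∫ x, h x * u x ^ 2 ∂μ ≤
      2 * ∫ x, h x * v x ^ 2 ∂μ + 2 * H * (eLpNorm (fun x => v x - u x) 2 μ).toReal ^ 2 := by
  have hvu : MemLp (fun x => v x - u x) 2 μ := hv.sub hu
  have e : (eLpNorm (fun x => v x - u x) 2 μ).toReal ^ 2 = ∫ x, (v x - u x) ^ 2 ∂μ := by
    have := hvu.eLpNorm_eq_integral_rpow_norm (by norm_num) (by norm_num)
    rw [this, ENNReal.toReal_ofReal (by positivity)]
    simp only [ENNReal.toReal_ofNat, Real.rpow_ofNat, Real.norm_eq_abs, sq_abs]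
    rw [← Real.rpow_natCast, ← Real.rpow_mul (integral_nonneg fun x => sq_nonneg _)]
    norm_num
  rw [e, ← integral_const_mul, ← integral_const_mul, ← integral_add
    ((integrable_weight_mul_sq hh hH hv).const_mul _) (hvu.integrable_sq.const_mul _)]
  refine integral_mono_ae (integrable_weight_mul_sq hh hH hu)
    (((integrable_weight_mul_sq hh hH hv).const_mul _).add (hvu.integrable_sq.const_mul _)) ?_
  filter_upwards [h0, hH] with x hx hxH
  have h1 : h x * (v x - u x) ^ 2 ≤ H * (v x - u x) ^ 2 :=
    mul_le_mul_of_nonneg_right ((le_abs_self _).trans hxH) (sq_nonneg _)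
  have h2 : 0 ≤ h x * (2 * v x - u x) ^ 2 := mul_nonneg hx (sq_nonneg _)
  nlinarith

theorem tendsto_toReal_sq_of_tendsto_zero {a : ℕ → ℝ≥0∞} (ha : Tendsto a atTop (𝓝 0)) :
    Tendsto (fun m => (a m).toReal ^ 2) atTop (𝓝 0) := by
  have := ((ENNReal.continuousAt_toReal ENNReal.zero_ne_top).tendsto.comp ha).pow 2
  simpa using this

end Approximation

/-! ### The Carleman estimate on $H^2_0$. -/

section HZero

variable {n : ℕ} {Ω : Set (EuclideanSpace ℝ (Fin n))} {F L : EuclideanSpace ℝ (Fin n) → ℝ}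
  {P : EuclideanSpace ℝ (Fin n) → EuclideanSpace ℝ (Fin n)}

theorem MemSobolev.memLp_weakDeriv {k m : ℕ} {p : ℝ≥0∞} {g : EuclideanSpace ℝ (Fin n) → ℝ}
    (hF : MemSobolev m p Ω F) (hΩ : IsOpen Ω) (hk : k ≤ m)
    {v : Fin k → EuclideanSpace ℝ (Fin n)} (hg : HasWeakDeriv Ω v F g) :
    MemLp g p (volume.restrict Ω) := by
  obtain ⟨g', hg', hw⟩ := hF k hk v
  exact (memLp_congr_ae (hg.ae_eq hΩ hw)).2 hg'

theorem MemSobolev.memLp_weakGradient {p : ℝ≥0∞} (hF : MemSobolev 2 p Ω F) (hΩ : IsOpen Ω)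
    (hP : HasWeakGradient Ω F P) : MemLp P p (volume.restrict Ω) := by
  have h (i : Fin n) : MemLp (fun x => inner ℝ (P x) (EuclideanSpace.single i 1)) p
      (volume.restrict Ω) := hF.memLp_weakDeriv hΩ (by norm_num) (hP _)
  have e : P = fun x => ∑ i, (ContinuousLinearMap.toSpanSingleton ℝ (EuclideanSpace.single i 1))
      (inner ℝ (P x) (EuclideanSpace.single i (1 : ℝ))) := by
    funext x
    simpa [real_inner_comm] using ((EuclideanSpace.basisFun (Fin n) ℝ).sum_repr' (P x)).symm
  rw [e]
  exact memLp_finsetSum _ fun i _ => (ContinuousLinearMap.toSpanSingleton ℝ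
    (EuclideanSpace.single i (1 : ℝ))).comp_memLp' (h i)

theorem MemSobolev.memLp_weakLaplacian (hF : MemSobolev 2 2 Ω F) (hΩ : IsOpen Ω)
    (hL : HasWeakLaplacian Ω F L) : MemLp L 2 (volume.restrict Ω) := by
  choose g hg hw using fun i : Fin n => hF 2 le_rfl
    ![EuclideanSpace.single i 1, EuclideanSpace.single i 1]
  exact (memLp_congr_ae (hL.ae_eq_sum hΩ hw)).2 (memLp_finsetSum _ fun i _ => hg i)

theorem IsTestFunction.memLp_iteratedFDeriv {φ : EuclideanSpace ℝ (Fin n) → ℝ}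
    (hφ : IsTestFunction Ω φ) {k : ℕ} (v : Fin k → EuclideanSpace ℝ (Fin n)) (p : ℝ≥0∞) :
    MemLp (fun x => iteratedFDeriv ℝ k φ x v) p (volume.restrict Ω) := by
  have hc : Continuous fun x => iteratedFDeriv ℝ k φ x v :=
    (ContinuousMultilinearMap.apply ℝ
      (fun _ : Fin k => EuclideanSpace ℝ (Fin n)) ℝ v).continuous.comp
      (hφ.smooth.continuous_iteratedFDeriv (WithTop.coe_le_coe.2 le_top))
  have hs : HasCompactSupport fun x => iteratedFDeriv ℝ k φ x v :=
    (hφ.compactSupport.iteratedFDeriv (𝕜 := ℝ) k).comp_left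
      (g := fun A : EuclideanSpace ℝ (Fin n) [×k]→L[ℝ] ℝ => A v) rfl
  exact (hc.memLp_of_hasCompactSupport hs).restrict Ω

theorem coordLaplacian_eq_sum_iteratedFDeriv {φ : EuclideanSpace ℝ (Fin n) → ℝ}
    (hφ : ContDiff ℝ 2 φ) (x : EuclideanSpace ℝ (Fin n)) :
    coordLaplacian φ x = ∑ i, iteratedFDeriv ℝ 2 φ x
      ![EuclideanSpace.single i 1, EuclideanSpace.single i 1] := by
  refine Finset.sum_congr rfl fun i _ => ?_
  rw [partialD_partialD_eq hφ.contDiffAt, iteratedFDeriv_two_apply]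
  simp

/-- A function in `H²_0` is approximated by test functions together with its weak gradient and its
weak Laplacian. -/
theorem MemHZero.exists_approx (hF : MemHZero 2 Ω F) (hΩ : IsOpen Ω)
    (hP : HasWeakGradient Ω F P) (hL : HasWeakLaplacian Ω F L) :
    ∃ φ : ℕ → EuclideanSpace ℝ (Fin n) → ℝ, (∀ m, IsTestFunction Ω (φ m)) ∧
      Tendsto (fun m => eLpNorm (fun x => φ m x - F x) 2 (volume.restrict Ω)) atTop (𝓝 0) ∧
      (∀ i, Tendsto (fun m => eLpNorm (fun x => partialD i (φ m) x -
        inner ℝ (P x) (EuclideanSpace.single i 1)) 2 (volume.restrict Ω)) atTop (𝓝 0)) ∧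
      Tendsto (fun m => eLpNorm (fun x => coordLaplacian (φ m) x - L x) 2
        (volume.restrict Ω)) atTop (𝓝 0) := by
  obtain ⟨hS, φ, hφ, hlim⟩ := hF
  refine ⟨φ, hφ, ?_, fun i => ?_, ?_⟩
  · simpa using hlim 0 (by norm_num) Fin.elim0 F (hasWeakDeriv_zero hL.1 _)
  · simpa [partialD, iteratedFDeriv_one_apply] using hlim 1 (by norm_num) _ _
      (hP (EuclideanSpace.single i 1))
  · choose g hg hw using fun i : Fin n => hS 2 le_rfl
      ![EuclideanSpace.single i 1, EuclideanSpace.single i 1]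
    have h0 : Tendsto (fun m => ∑ i, eLpNorm (fun x => iteratedFDeriv ℝ 2 (φ m) x
        ![EuclideanSpace.single i 1, EuclideanSpace.single i 1] - g i x) 2
        (volume.restrict Ω)) atTop (𝓝 0) := by
      simpa using tendsto_finsetSum Finset.univ fun i _ => hlim 2 le_rfl _ _ (hw i)
    refine tendsto_of_tendsto_of_tendsto_of_le_of_le tendsto_const_nhds h0
      (fun _ => zero_le) fun m => ?_
    refine le_trans (eLpNorm_congr_ae ?_).le (eLpNorm_sum_le (fun i _ =>
      (((hφ m).memLp_iteratedFDeriv _ 2).sub (hg i)).aestronglyMeasurable) (by norm_num))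
    filter_upwards [hL.ae_eq_sum hΩ hw] with x hx
    rw [hx, coordLaplacian_eq_sum_iteratedFDeriv
      ((hφ m).smooth.of_le (WithTop.coe_le_coe.2 le_top)), ← Finset.sum_sub_distrib]
    simp

theorem norm_sq_eq_sum_inner_single (p : EuclideanSpace ℝ (Fin n)) :
    ‖p‖ ^ 2 = ∑ i, inner ℝ p (EuclideanSpace.single i (1 : ℝ)) ^ 2 := by
  simp [EuclideanSpace.norm_sq_eq, EuclideanSpace.inner_single_right]

/-- The Carleman estimate on `H²_0(Ω)`. -/
theorem MemHZero.carleman_estimate {d a : EuclideanSpace ℝ (Fin n) → ℝ}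
    {b : EuclideanSpace ℝ (Fin n) → Fin n → ℝ} {c M τ B : ℝ} (hF : MemHZero 2 Ω F)
    (hΩ : IsOpen Ω) (hP : HasWeakGradient Ω F P) (hL : HasWeakLaplacian Ω F L) (hc : 0 < c)
    (h : ∀ x ∈ Ω, IsCarlemanWeightAt d a b c M x) (hB : ∀ x ∈ Ω, |d x| ≤ B)
    (hτ : 1 ≤ τ) (hτc : 13 * M ^ 2 + 3 ≤ c * τ) :
    τ * c * ∫ x in Ω, Real.exp (2 * τ * d x) * (‖P x‖ ^ 2 + F x ^ 2) ≤
      4 * (2 * M ^ 2 + 3) * ∫ x in Ω, Real.exp (2 * τ * d x) * L x ^ 2 := by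
  set μ := (volume : Measure (EuclideanSpace ℝ (Fin n))).restrict Ω with hμ
  set w : EuclideanSpace ℝ (Fin n) → ℝ := fun x => Real.exp (2 * τ * d x) with hw
  set H := Real.exp (2 * τ * B) with hHdef
  set K := 2 * M ^ 2 + 3 with hK
  have hK0 : 0 ≤ K := by positivity
  have hwc : ContinuousOn w Ω := fun x hx =>
    (continuousAt_const.mul (h x hx).contDiffAt.continuousAt).rexp.continuousWithinAt
  have hwm : AEStronglyMeasurable w μ := hwc.aestronglyMeasurable hΩ.measurableSet
  have hw0 : ∀ᵐ x ∂μ, 0 ≤ w x := Eventually.of_forall fun x => (Real.exp_pos _).le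
  have hwH : ∀ᵐ x ∂μ, |w x| ≤ H := by
    filter_upwards [ae_restrict_mem hΩ.measurableSet] with x hx
    rw [abs_of_pos (Real.exp_pos _), hHdef, Real.exp_le_exp]
    have := (le_abs_self _).trans (hB x hx)
    have : 0 ≤ 2 * τ := by linarith
    gcongr
  obtain ⟨φ, hφ, l0, l1, l2⟩ := hF.exists_approx hΩ hP hL
  have hFm := hF.1.memLp hΩ
  have hLm := hF.1.memLp_weakLaplacian hΩ hL
  have hPm (i : Fin n) : MemLp (fun x => inner ℝ (P x) (EuclideanSpace.single i 1)) 2 μ :=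
    hF.1.memLp_weakDeriv hΩ (by norm_num) (hP _)
  have hφ2 (m : ℕ) : ContDiff ℝ 2 (φ m) := (hφ m).smooth.of_le (WithTop.coe_le_coe.2 le_top)
  have m0 (m : ℕ) : MemLp (φ m) 2 μ := by
    simpa using (hφ m).memLp_iteratedFDeriv Fin.elim0 2
  have m1 (m : ℕ) (i : Fin n) : MemLp (partialD i (φ m)) 2 μ := by
    change MemLp (fun x => fderiv ℝ (φ m) x (EuclideanSpace.single i 1)) 2 μ
    simpa [iteratedFDeriv_one_apply] using
      (hφ m).memLp_iteratedFDeriv ![EuclideanSpace.single i 1] 2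
  have m2 (m : ℕ) : MemLp (coordLaplacian (φ m)) 2 μ := by
    rw [funext (coordLaplacian_eq_sum_iteratedFDeriv (hφ2 m))]
    exact memLp_finsetSum _ fun i _ => (hφ m).memLp_iteratedFDeriv _ 2
  have split (u : EuclideanSpace ℝ (Fin n) → ℝ) (q : Fin n → EuclideanSpace ℝ (Fin n) → ℝ)
      (hu : MemLp u 2 μ) (hq : ∀ i, MemLp (q i) 2 μ) :
      ∫ x, w x * (∑ i, q i x ^ 2 + u x ^ 2) ∂μ =
        ∑ i, ∫ x, w x * q i x ^ 2 ∂μ + ∫ x, w x * u x ^ 2 ∂μ := by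
    simp only [mul_add, Finset.mul_sum]
    rw [integral_add (integrable_finsetSum _ fun i _ => integrable_weight_mul_sq hwm hwH (hq i))
      (integrable_weight_mul_sq hwm hwH hu),
      integral_finsetSum _ fun i _ => integrable_weight_mul_sq hwm hwH (hq i)]
  -- The comparison is used twice, from $F$ to the test function on the left and back on the right;
  -- each costs a factor 2, hence the 4. The remaining terms tend to zero.
  have hstep (m : ℕ) : τ * c * ∫ x, w x * (‖P x‖ ^ 2 + F x ^ 2) ∂μ ≤
      4 * K * ∫ x, w x * L x ^ 2 ∂μ +
        (2 * H * (τ * c) * (∑ i, (eLpNorm (fun x => partialD i (φ m) x -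
          inner ℝ (P x) (EuclideanSpace.single i 1)) 2 μ).toReal ^ 2 +
          (eLpNorm (fun x => φ m x - F x) 2 μ).toReal ^ 2) +
        4 * K * H * (eLpNorm (fun x => coordLaplacian (φ m) x - L x) 2 μ).toReal ^ 2) := by
    have e1 : τ * c * ∫ x, w x * (gradDot (φ m) (φ m) x + φ m x ^ 2) ∂μ ≤
        K * ∫ x, w x * coordLaplacian (φ m) x ^ 2 ∂μ := by
      have h0 := _root_.carleman_estimate hc h hτ hτc (hφ m)
      have hz {x : EuclideanSpace ℝ (Fin n)} (hx : x ∉ Ω) : φ m =ᶠ[𝓝 x] 0 :=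
        notMem_tsupport_iff_eventuallyEq.1 fun hx' => hx ((hφ m).support_subset hx')
      rw [hμ, setIntegral_eq_integral_of_forall_compl_eq_zero fun x hx => ?_,
        setIntegral_eq_integral_of_forall_compl_eq_zero fun x hx => ?_]
      · exact h0
      · simp [coordLaplacian, (((hz hx).partialD_zero _).partialD_zero _).eq_of_nhds]
      · simp [gradDot, ((hz hx).partialD_zero _).eq_of_nhds, (hz hx).eq_of_nhds]
    have e2 : ∫ x, w x * (‖P x‖ ^ 2 + F x ^ 2) ∂μ ≤
        2 * ∫ x, w x * (gradDot (φ m) (φ m) x + φ m x ^ 2) ∂μ +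
          2 * H * (∑ i, (eLpNorm (fun x => partialD i (φ m) x -
          inner ℝ (P x) (EuclideanSpace.single i 1)) 2 μ).toReal ^ 2 +
          (eLpNorm (fun x => φ m x - F x) 2 μ).toReal ^ 2) := by
      have hg (x : EuclideanSpace ℝ (Fin n)) :
          gradDot (φ m) (φ m) x = ∑ i, partialD i (φ m) x ^ 2 := by simp [gradDot, sq]
      simp only [hg, norm_sq_eq_sum_inner_single]
      rw [split _ _ hFm hPm, split _ _ (m0 m) (m1 m)]
      have k1 := Finset.sum_le_sum fun i (_ : i ∈ Finset.univ) =>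
        integral_weight_mul_sq_le hwm hw0 hwH (hPm i) (m1 m i)
      have k2 := integral_weight_mul_sq_le hwm hw0 hwH hFm (m0 m)
      rw [Finset.sum_add_distrib, ← Finset.mul_sum, ← Finset.mul_sum] at k1
      linarith
    have e3 := integral_weight_mul_sq_le hwm hw0 hwH (m2 m) hLm
    have e4 : eLpNorm (fun x => L x - coordLaplacian (φ m) x) 2 μ =
        eLpNorm (fun x => coordLaplacian (φ m) x - L x) 2 μ := eLpNorm_sub_comm _ _ _ _
    rw [e4] at e3
    have e5 := mul_le_mul_of_nonneg_left e2 (by positivity : 0 ≤ τ * c)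
    have e6 := mul_le_mul_of_nonneg_left e3 hK0
    linarith
  have hlim : Tendsto (fun m => 4 * K * ∫ x, w x * L x ^ 2 ∂μ +
        (2 * H * (τ * c) * (∑ i, (eLpNorm (fun x => partialD i (φ m) x -
          inner ℝ (P x) (EuclideanSpace.single i 1)) 2 μ).toReal ^ 2 +
          (eLpNorm (fun x => φ m x - F x) 2 μ).toReal ^ 2) +
        4 * K * H * (eLpNorm (fun x => coordLaplacian (φ m) x - L x) 2 μ).toReal ^ 2))
      atTop (𝓝 (4 * K * ∫ x, w x * L x ^ 2 ∂μ +
        (2 * H * (τ * c) * (∑ _i : Fin n, (0 : ℝ) + 0) + 4 * K * H * 0))) :=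
    tendsto_const_nhds.add ((((tendsto_finsetSum _ fun i _ =>
      tendsto_toReal_sq_of_tendsto_zero (l1 i)).add
      (tendsto_toReal_sq_of_tendsto_zero l0)).const_mul _).add
      ((tendsto_toReal_sq_of_tendsto_zero l2).const_mul _))
  have := ge_of_tendsto' hlim hstep
  simpa using this

end HZero

/-! ### Measurability of the coefficients and the final absorption. -/

theorem measurable_gradient {n : ℕ} (f : EuclideanSpace ℝ (Fin n) → ℝ) : Measurable (gradient f) :=
  (InnerProductSpace.toDual ℝ (EuclideanSpace ℝ (Fin n))).symm.continuous.measurable.comp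
    (measurable_fderiv ℝ f)

theorem measurable_laplacian {n : ℕ} (f : EuclideanSpace ℝ (Fin n) → ℝ) :
    Measurable (Laplacian.laplacian f) := by
  rw [InnerProductSpace.laplacian_eq_iteratedFDeriv_orthonormalBasis f
    (EuclideanSpace.basisFun (Fin n) ℝ)]
  refine Finset.measurable_fun_sum _ fun i _ => ?_
  simp only [iteratedFDeriv_two_apply]
  have h := measurable_fderiv_apply_const ℝ (fderiv ℝ f) (EuclideanSpace.basisFun (Fin n) ℝ i)
  exact (ContinuousLinearMap.apply ℝ ℝ
    (EuclideanSpace.basisFun (Fin n) ℝ i)).continuous.measurable.comp h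

theorem sq_add_add_le_three_mul (a b c : ℝ) :
    (a + b + c) ^ 2 ≤ 3 * (a ^ 2 + b ^ 2 + c ^ 2) := by
  nlinarith [sq_nonneg (a - b), sq_nonneg (b - c), sq_nonneg (a - c)]

/-- A function of the form `r L + 2 q · P + s F` controls `L` pointwise, up to lower order terms. -/
theorem sq_mul_sq_le_of_eq {E : Type*} [NormedAddCommGroup E] [InnerProductSpace ℝ E]
    {G r l s f r₀ M : ℝ} {q p : E} (hG : G = r * l + 2 * inner ℝ q p + s * f) (hr₀ : 0 ≤ r₀)
    (hr : r₀ ≤ |r|) (hq : ‖q‖ ≤ M) (hs : |s| ≤ M) :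
    r₀ ^ 2 * l ^ 2 ≤ 3 * G ^ 2 + 12 * M ^ 2 * (‖p‖ ^ 2 + f ^ 2) := by
  have h1 : inner ℝ q p ^ 2 ≤ M ^ 2 * ‖p‖ ^ 2 := by
    rw [← mul_pow, ← sq_abs]
    refine pow_le_pow_left₀ (abs_nonneg _) ((abs_real_inner_le_norm q p).trans ?_) 2
    exact mul_le_mul_of_nonneg_right hq (norm_nonneg _)
  have h2 : s ^ 2 * f ^ 2 ≤ M ^ 2 * f ^ 2 :=
    mul_le_mul_of_nonneg_right (sq_le_sq' (by linarith [abs_le.1 hs]) (abs_le.1 hs).2)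
      (sq_nonneg f)
  have h3 : r₀ ^ 2 * l ^ 2 ≤ (r * l) ^ 2 := by
    rw [mul_pow, ← sq_abs r]
    gcongr
  -- The 12 is $3\cdot2^2$, from the factor 2 before the inner product; the coefficient 3 of the
  -- last term is enlarged to match.
  have h4 := sq_add_add_le_three_mul G (-(2 * inner ℝ q p)) (-(s * f))
  have h5 : r * l = G + -(2 * inner ℝ q p) + -(s * f) := by rw [hG]; ring
  rw [← h5] at h4
  have : 0 ≤ M ^ 2 * f ^ 2 := by positivity
  nlinarith

theorem proposition3p1 {n : ℕ} (hn : 2 ≤ n)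
    (Ω : Set (EuclideanSpace ℝ (Fin n)))
    (hΩo : IsOpen Ω) (hΩc : IsConnected Ω) (hΩb : Bornology.IsBounded Ω) (hΩ : HasC2Boundary Ω)
    (Γ₀ Γ₁ : Set (EuclideanSpace ℝ (Fin n)))
    (hΓ : frontier Ω = closure (Γ₀ ∪ Γ₁)) (hΓd : Disjoint Γ₀ Γ₁)
    (c₀ : ℝ) (D : EuclideanSpace ℝ (Fin n) → ℝ) (hD : IsAdmissibleCoefficient Ω c₀ D)
    (d : EuclideanSpace ℝ (Fin n) → ℝ) (hd : GeometricAssumptions Ω Γ₀ (conformalMetric D) d)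
    (T : ℝ) (hT : 0 < T)
    (R : EuclideanSpace ℝ (Fin n) × ℝ → ℝ)
    (hR : MemSobolev 3 ⊤ (Ω ×ˢ Set.Ioo 0 T) R)
    -- `R` is the continuous representative, so that its values at `t = 0` are meaningful
    (hRc : ContinuousOn R (Ω ×ˢ Set.Ico 0 T))
    (r₀ : ℝ) (hr₀ : 0 < r₀) :
    ∃ C > 0, ∃ τ₀ > 0,
      ∀ K : Set (EuclideanSpace ℝ (Fin n)), IsCompact K → K ⊆ Ω → HasC2Boundary K →
      (∀ᵐ x ∂(volume.restrict K), r₀ ≤ |R (x, 0)|) →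
      -- `P` and `L` are the weak gradient and the weak Laplacian of `F`,
      -- and `G` is the function `w_tt(·, 0)`
      ∀ (F : EuclideanSpace ℝ (Fin n) → ℝ) (P : EuclideanSpace ℝ (Fin n) → EuclideanSpace ℝ (Fin n))
        (L G : EuclideanSpace ℝ (Fin n) → ℝ),
      MemHZero 2 Ω F → EssSupportedIn Ω F (interior K) →
      HasWeakGradient Ω F P → HasWeakLaplacian Ω F L →
      (∀ᵐ x ∂(volume.restrict Ω),
        G x = R (x, 0) * L x
          + 2 * inner ℝ (gradient (fun y => R (y, 0)) x) (P x)
          + Laplacian.laplacian (fun y => R (y, 0)) x * F x) →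
      ∀ τ ≥ τ₀,
        IntegrableOn (fun x => Real.exp (2 * τ * d x) * (L x ^ 2 + ‖P x‖ ^ 2 + F x ^ 2)) Ω ∧
        IntegrableOn (fun x => Real.exp (2 * τ * d x) * G x ^ 2) Ω ∧
        ∫ x in Ω, Real.exp (2 * τ * d x) * (L x ^ 2 + ‖P x‖ ^ 2 + F x ^ 2)
          ≤ C * ∫ x in Ω, Real.exp (2 * τ * d x) * G x ^ 2 := by
  obtain ⟨a, b, c, M, hc, hw⟩ := hd.exists_isCarlemanWeightAt hΩo hΩb hD
  obtain ⟨B, hB⟩ := hΩb.isCompact_closure.exists_bound_of_continuousOn hd.contDiffOn.continuousOn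
  obtain ⟨N, hN⟩ := exists_trace_bounds hΩo hΩb hT hR hRc
  set A := 4 * (2 * M ^ 2 + 3) with hA
  have hA0 : 0 < A := by positivity
  -- The three summands of $\tau_0$ ensure respectively $\tau\ge1$, the threshold of the Carleman
  -- estimate, and the absorption of the lower-order terms. The factor $6/r_0^2$ bounds the $\Delta
  -- F$ integral, and $1+A/c$ adds the integrals of $\nabla F$ and $F$.
  refine ⟨(1 + A / c) * (6 / r₀ ^ 2), by positivity,
    1 + (13 * M ^ 2 + 3) / c + 24 * N ^ 2 * A / (c * r₀ ^ 2), by positivity, ?_⟩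
  intro K hK hKΩ _ hRK F P L G hF hsupp hP hL hG τ hτ
  have q1 : 0 ≤ (13 * M ^ 2 + 3) / c := by positivity
  have q2 : 0 ≤ 24 * N ^ 2 * A / (c * r₀ ^ 2) := by positivity
  have hτ1 : 1 ≤ τ := by linarith
  have hτM : 13 * M ^ 2 + 3 ≤ c * τ := by
    rw [← div_le_iff₀' hc]; linarith
  have hτN : 24 * N ^ 2 * A ≤ τ * (c * r₀ ^ 2) := by
    rw [← div_le_iff₀ (by positivity)]; linarith
  have hcar := hF.carleman_estimate hΩo hP hL hc hw (fun x hx => hB x (subset_closure hx)) hτ1 hτM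
  set μ := (volume : Measure (EuclideanSpace ℝ (Fin n))).restrict Ω with hμ
  set w : EuclideanSpace ℝ (Fin n) → ℝ := fun x => Real.exp (2 * τ * d x) with hwdef
  have hw0 (x : EuclideanSpace ℝ (Fin n)) : 0 ≤ w x := (Real.exp_pos _).le
  have hwm : AEStronglyMeasurable w μ := ContinuousOn.aestronglyMeasurable (fun x hx =>
    (continuousAt_const.mul (hw x hx).contDiffAt.continuousAt).rexp.continuousWithinAt)
    hΩo.measurableSet
  have hwH : ∀ᵐ x ∂μ, |w x| ≤ Real.exp (2 * τ * B) := by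
    filter_upwards [ae_restrict_mem hΩo.measurableSet] with x hx
    rw [abs_of_pos (Real.exp_pos _), Real.exp_le_exp]
    have := (le_abs_self _).trans (hB x (subset_closure hx))
    have : 0 ≤ 2 * τ := by linarith
    gcongr
  have hFm : MemLp F 2 μ := hF.1.memLp hΩo
  have hLm : MemLp L 2 μ := hF.1.memLp_weakLaplacian hΩo hL
  have hPm : MemLp P 2 μ := hF.1.memLp_weakGradient hΩo hP
  have hGm : MemLp G 2 μ := by
    have hR0 : AEStronglyMeasurable (fun x => R (x, 0)) μ := ContinuousOn.aestronglyMeasurable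
      (hRc.comp (by fun_prop) fun x hx => ⟨hx, left_mem_Ico.2 hT⟩) hΩo.measurableSet
    have hb := ae_restrict_mem (μ := volume) hΩo.measurableSet
    have g1 : MemLp (fun x => R (x, 0) * L x) 2 μ := by
      refine MemLp.of_le_mul (c := N) hLm (hR0.mul hLm.1) ?_
      filter_upwards [hb] with x hx
      rw [norm_mul]
      exact mul_le_mul_of_nonneg_right (hN x hx).1 (norm_nonneg _)
    have g2 : MemLp (fun x => inner ℝ (gradient (fun y => R (y, 0)) x) (P x)) 2 μ := by
      refine MemLp.of_le_mul (c := N) hPm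
        ((measurable_gradient _).aestronglyMeasurable.inner hPm.1) ?_
      filter_upwards [hb] with x hx
      exact (norm_inner_le_norm _ _).trans
        (mul_le_mul_of_nonneg_right (hN x hx).2.1 (norm_nonneg _))
    have g3 : MemLp (fun x => Laplacian.laplacian (fun y => R (y, 0)) x * F x) 2 μ := by
      refine MemLp.of_le_mul (c := N) hFm
        ((measurable_laplacian _).aestronglyMeasurable.mul hFm.1) ?_
      filter_upwards [hb] with x hx
      rw [norm_mul]
      exact mul_le_mul_of_nonneg_right (hN x hx).2.2 (norm_nonneg _)
    exact (memLp_congr_ae hG).2 ((g1.add (g2.const_mul 2)).add g3)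
  have iL := integrable_weight_mul_sq hwm hwH hLm
  have iF := integrable_weight_mul_sq hwm hwH hFm
  have iP := integrable_weight_mul_sq hwm hwH hPm.norm
  have iG := integrable_weight_mul_sq hwm hwH hGm
  have iPF : Integrable (fun x => w x * (‖P x‖ ^ 2 + F x ^ 2)) μ := by
    simp only [mul_add]
    exact iP.add iF
  have hsum : (fun x => w x * (L x ^ 2 + ‖P x‖ ^ 2 + F x ^ 2)) =
      fun x => w x * L x ^ 2 + w x * (‖P x‖ ^ 2 + F x ^ 2) := by
    funext x; ring
  refine ⟨?_, iG, ?_⟩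
  · change Integrable (fun x => w x * (L x ^ 2 + ‖P x‖ ^ 2 + F x ^ 2)) μ
    rw [hsum]
    exact iL.add iPF
  obtain ⟨S, hS, hSK, hFS⟩ := hsupp
  have hLS := ae_eq_zero_of_weak_local hΩo hS hFS hL.2.1 Laplacian.laplacian
    (fun φ x hx => laplacian_eq_zero_of_notMem_tsupport hx) hL.2.2
  have hpt : ∀ᵐ x ∂μ, r₀ ^ 2 * (w x * L x ^ 2) ≤
      3 * (w x * G x ^ 2) + 12 * N ^ 2 * (w x * (‖P x‖ ^ 2 + F x ^ 2)) := by
    have hRK' : ∀ᵐ x ∂μ, x ∈ K → r₀ ≤ |R (x, 0)| :=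
      ae_restrict_of_ae ((ae_restrict_iff' hK.measurableSet).1 hRK)
    -- On the support of $F$, contained in $K$, the bound $|R|\ge r_0$ applies; off it the left side
    -- is zero.
    filter_upwards [hLS, hG, hRK', ae_restrict_mem hΩo.measurableSet] with x h1 h2 h3 h4
    by_cases hx : x ∈ S
    · have := sq_mul_sq_le_of_eq h2 hr₀.le (h3 (interior_subset (hSK hx))) (hN x h4).2.1
        (hN x h4).2.2
      have := mul_le_mul_of_nonneg_left this (hw0 x)
      linarith
    · rw [h1 hx]
      have := hw0 x
      have : 0 ≤ 3 * (w x * G x ^ 2) + 12 * N ^ 2 * (w x * (‖P x‖ ^ 2 + F x ^ 2)) := by positivity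
      simpa using this
  have hint := integral_mono_ae (iL.const_mul _) ((iG.const_mul _).add (iPF.const_mul _)) hpt
  simp only [Pi.add_apply] at hint
  rw [integral_add (iG.const_mul _) (iPF.const_mul _), integral_const_mul, integral_const_mul,
    integral_const_mul] at hint
  rw [hsum, integral_add iL iPF]
  set IL := ∫ x, w x * L x ^ 2 ∂μ
  set IP := ∫ x, w x * (‖P x‖ ^ 2 + F x ^ 2) ∂μ
  set IG := ∫ x, w x * G x ^ 2 ∂μ
  have hIL : 0 ≤ IL := integral_nonneg fun x => mul_nonneg (hw0 x) (sq_nonneg _)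
  have hIP : 0 ≤ IP := integral_nonneg fun x => mul_nonneg (hw0 x) (by positivity)
  have hτc : 0 < τ * c := by positivity
  -- The Carleman estimate makes the lower-order error at most half of $r_0^2\int e^{2\tau d}|\Delta
  -- F|^2$, which can be subtracted because that integral is finite.
  have k1 : 12 * N ^ 2 * IP ≤ r₀ ^ 2 / 2 * IL := by
    refine le_of_mul_le_mul_left ?_ hτc
    have e1 := mul_le_mul_of_nonneg_left hcar (by positivity : 0 ≤ 12 * N ^ 2)
    have e2 := mul_le_mul_of_nonneg_right hτN hIL
    linarith
  have k2 : IL ≤ 6 / r₀ ^ 2 * IG := by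
    rw [div_mul_eq_mul_div, le_div_iff₀ (by positivity)]
    linarith
  have k3 : IP ≤ A / c * IL := by
    rw [div_mul_eq_mul_div, le_div_iff₀ hc]
    have : 1 * (c * IP) ≤ τ * (c * IP) := mul_le_mul_of_nonneg_right hτ1 (by positivity)
    linarith
  calc IL + IP ≤ (1 + A / c) * IL := by linarith
    _ ≤ (1 + A / c) * (6 / r₀ ^ 2 * IG) := by gcongr
    _ = _ := by ring
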